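/- Let $I\subseteq\mathbb R$ be an interval that is unbounded from above, and let $1\le k\le n$ be integers. For an interval $J\subseteq\mathbb R$ of nonzero length, let $\mathcal F_+^{k:n}(J)$ be the set of all functions $g\colon J\to\mathbb R$ for which there are functions $g^{(0)}=g,\,g^{(1)},\dots,g^{(n)}$ on $J$ such that, for each $j\in\{0,\dots,n-1\}$, the function $g^{(j+1)}$ is right-continuous at every point of $J$ other than $\sup J$, is left-continuous at $\sup J$ if $\sup J\in J$, is integrable on compact subintervals of $J$, and satisfies $g^{(j)}(x)=g^{(j)}(y)+\int_y^x g^{(j+1)}(u)\,du$ for all $x,y\in J$ (these functions are uniquely determined by $g$), and such that $g^{(j)}$ is nondecreasing on $J$ for each $j\in\{k-1,\dots,n\}$. Let $$\mathcal F_-^{k:n}(I)=\{x\mapsto g(-x)\colon g\in\mathcal F_+^{k:n}(-I)\},\qquad -I=\{-x\colon x\in I\}.$$ Expectations are understood in the extended sense: $\mathsf E Z=\mathsf E Z_+-\mathsf E Z_-\in[-\infty,\infty]$, which exists if at least one of $\mathsf E Z_+,\mathsf E Z_-$ is finite; a relation that involves expectations means that they exist and satisfy the relation. Let $X$ and $Y$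 be random variables (possibly on different probability spaces) with values in $I$, such that $\mathsf E p(X)>-\infty$ and $\mathsf E p(Y)>-\infty$ for every real polynomial $p$ of degree $\le k$ with $(-1)^kp^{(k)}\ge0$. Let $s$ and $z$ be any real numbers. Then $$\mathsf E f(X)\ge\mathsf E f(Y)\quad\text{for all }f\in\mathcal F_-^{k:n}(I)$$ if and only if all of the following conditions hold: (i) $\mathsf E(X-s)^i=\mathsf E(Y-s)^i\in\mathbb R$ for all $i\in\{1,\dots,k-1\}$; (ii) $\mathsf E(z-X)^k\ge\mathsf E(z-Y)^k$; (iii) $\mathsf E(t-X)_+^n\ge\mathsf E(t-Y)_+^n$ for all $t\in I$, where $u_+=\max(u,0)$. -/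

import Mathlib

open MeasureTheory Set
open scoped Pointwise ENNReal

noncomputable section

namespace MultiplyMonotone

/-!
Functions on an interval `I` are represented by functions `ℝ → ℝ`; every condition below concerns
only their values on `I`.
-/

/-- The functions that are right-continuous on `I` without its right endpoint, and left-continuous
at the right endpoint of `I` in case this endpoint belongs to `I`. -/
def LD (I : Set ℝ) : Set (ℝ → ℝ) :=
  {g | (∀ x ∈ I, ¬ IsGreatest I x → ContinuousWithinAt g (I ∩ Ici x) x) ∧
    (∀ x, IsGreatest I x → ContinuousWithinAt g (I ∩ Iic x) x)}

/-- `g` is the generalized derivative of `f` on `I`: `g` is in `LD I`, it is integrable on compact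
subintervals of `I`, and `f` is an indefinite integral of `g` on `I`. Such a `g` is unique on `I`
and equals the derivative of `f` almost everywhere on `I`. -/
def IsGenDeriv (I : Set ℝ) (f g : ℝ → ℝ) : Prop :=
  g ∈ LD I ∧ ∀ x ∈ I, ∀ z ∈ I,
    IntervalIntegrable g volume z x ∧ f x = f z + ∫ u in z..x, g u

/-- `f` is in the class `𝓛ⁿ(I)` and `D 0, …, D n` are its generalized derivatives
`f⁽⁰⁾ = f, f⁽¹⁾, …, f⁽ⁿ⁾` on `I`. The class `𝓛⁰(I)` consists of all Borel functions on `I`. -/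
structure HasGenDerivs (I : Set ℝ) (n : ℕ) (f : ℝ → ℝ) (D : ℕ → ℝ → ℝ) : Prop where
  measurable : Measurable (fun x : I => f x)
  zero : EqOn (D 0) f I
  succ : ∀ j < n, IsGenDeriv I (D j) (D (j + 1))

/-- The cone `𝓕₊^{k:n}(I)`: the `f ∈ 𝓛ⁿ(I)` such that `f⁽ʲ⁾` is nondecreasing on `I` for all
`j` with `k - 1 ≤ j ≤ n`. -/
def FPlus (k n : ℕ) (I : Set ℝ) : Set (ℝ → ℝ) :=
  {f | ∃ D : ℕ → ℝ → ℝ, HasGenDerivs I n f D ∧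
    ∀ j, k ≤ j + 1 → j ≤ n → MonotoneOn (D j) I}

/-- The reflected cone `𝓕₋^{k:n}(I) = {x ↦ g (-x) : g ∈ 𝓕₊^{k:n}(-I)}`. -/
def FMinus (k n : ℕ) (I : Set ℝ) : Set (ℝ → ℝ) :=
  {f | ∃ g ∈ FPlus k n (-I), ∀ x, f x = g (-x)}

variable {Ω : Type*} [MeasurableSpace Ω]

/-- The expectation of `Z` exists in the extended sense: at least one of `E Z₊`, `E Z₋` is
finite. -/
def ExpExists (μ : Measure Ω) (Z : Ω → ℝ) : Prop :=
  AEMeasurable Z μ ∧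
    (∫⁻ ω, ENNReal.ofReal (Z ω) ∂μ ≠ ⊤ ∨ ∫⁻ ω, ENNReal.ofReal (-Z ω) ∂μ ≠ ⊤)

/-- The extended expectation `E Z = E Z₊ - E Z₋ ∈ [-∞, ∞]`, meaningful if `ExpExists μ Z`. -/
def extExp (μ : Measure Ω) (Z : Ω → ℝ) : EReal :=
  ((∫⁻ ω, ENNReal.ofReal (Z ω) ∂μ : ℝ≥0∞) : EReal) -
    ((∫⁻ ω, ENNReal.ofReal (-Z ω) ∂μ : ℝ≥0∞) : EReal)

end MultiplyMonotone

end

namespace MultiplyMonotone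

/-! ### Indefinite integrals and Taylor's formula -/

/-! Necessity is a matter of test functions: polynomials of degree less than `k` with both signs,
`(z - x)ᵏ`, and `(t - x)₊ⁿ` belong to the cone, except that the last may fail when `t = min I`,
where it vanishes on `I` anyway.

For sufficiency, reflect: `J = -I` is a lower set, and `P`, `Q` are the laws of `-X`, `-Y`. Write `k
+ 1` for the order `k` and `n = k + 1 + m`. Expand `g` in the cone on `J` at a point `a ∈ J` up to
degree `k`, with integral remainder in `g⁽ᵏ⁺¹⁾`. The Taylor polynomial has equal expectations by
(i). The function `g⁽ᵏ⁺¹⁾` is nonnegative and nondecreasing, so it splits as `c + H 0` with `c ≥ 0`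
its infimum over `J`. The constant contributes a nonnegative multiple of `(x - a)ᵏ⁺¹`, which (ii)
handles.

It remains to treat `H 0`. It and its derivatives up to `H m` are nonnegative, nondecreasing and
have infimum `0`, so `H 0` is the `m`-fold integral of `H m` from `-∞`. By the layer-cake formula `H
m` is a mixture of indicators of upper rays of `J`, so `H 0` is a mixture of truncated powers of
degree `m` (`lintegral_layer`, `layer_eq_zero_or_truncPow`). The Taylor remainder built on such a
power is the truncated power of degree `n` minus a polynomial of degree at most `k`, and (i) and
(iii) compare it (`expLE_integral_truncPow`).

Integrating over the mixture needs Tonelli for a signed kernel with possibly infinite expectations.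
Positive and negative parts are kept apart. The negative part is at most a constant times the
negative part of `(x - a)ᵏ⁺¹` (`taylorNeg_le`), which is integrable by admissibility. -/

/-- `F` is an indefinite integral of `g` on `J`. -/
def IsPrimitive (J : Set ℝ) (F g : ℝ → ℝ) : Prop :=
  ∀ x ∈ J, ∀ z ∈ J, IntervalIntegrable g volume z x ∧ F x = F z + ∫ u in z..x, g u

theorem integral_mul_of_isPrimitive {J : Set ℝ} (hJ : J.OrdConnected) {F g φ φ' : ℝ → ℝ}
    (hF : IsPrimitive J F g) {a b : ℝ} (ha : a ∈ J) (hb : b ∈ J)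
    (hφ : ∀ x, HasDerivAt φ (φ' x) x) (hφ' : Continuous φ') :
    ∫ u in a..b, φ u * g u = φ b * F b - φ a * F a - ∫ u in a..b, φ' u * F u := by
  have hg := (hF b hb a ha).1
  -- `F` is arbitrary off `J`. `G` agrees with it between `a` and `b`, and has derivative `g` almost
  -- everywhere there, even if `J` ends at `a` or `b`.
  set G : ℝ → ℝ := fun y => F a + ∫ u in a..y, g u with hG
  have hGF : ∀ y ∈ uIcc a b, G y = F y := fun y hy =>
    ((hF y (hJ.uIcc_subset ha hb hy) a ha).2).symm
  have hacφ : AbsolutelyContinuousOnInterval φ a b := by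
    apply ContDiffOn.absolutelyContinuousOnInterval
    apply ContDiff.contDiffOn
    rw [contDiff_one_iff_deriv]
    refine ⟨fun x => (hφ x).differentiableAt, ?_⟩
    have : deriv φ = φ' := funext fun x => (hφ x).deriv
    rwa [this]
  have hacI := hg.absolutelyContinuousOnInterval_intervalIntegral (c := a) (by simp)
  have hacc : AbsolutelyContinuousOnInterval (fun _ : ℝ => F a) a b :=
    ContDiffOn.absolutelyContinuousOnInterval contDiffOn_const
  have hacG : AbsolutelyContinuousOnInterval G a b := hacc.add hacI
  have key := hacφ.integral_mul_deriv_eq_deriv_mul hacG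
  rw [hGF a (by simp), hGF b (by simp)] at key
  have h1 : ∫ u in a..b, φ u * g u = ∫ u in a..b, φ u * deriv G u := by
    apply intervalIntegral.integral_congr_ae
    filter_upwards [hg.ae_hasDerivAt_integral] with x hx hx'
    have h2 := hx (uIoc_subset_uIcc hx') a (by simp)
    rw [((h2.const_add (F a)).deriv : deriv G x = g x)]
  have h2 : ∫ u in a..b, deriv φ u * G u = ∫ u in a..b, φ' u * F u := by
    apply intervalIntegral.integral_congr
    intro x hx
    simp only
    rw [hGF x hx, (hφ x).deriv]
  rw [h1, key, h2]

theorem taylor_of_isPrimitive {J : Set ℝ} (hJ : J.OrdConnected) {D : ℕ → ℝ → ℝ} {k : ℕ}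
    (hD : ∀ j < k + 1, IsPrimitive J (D j) (D (j + 1))) {a x : ℝ} (ha : a ∈ J) (hx : x ∈ J) :
    D 0 x = (∑ i ∈ Finset.range (k + 1), D i a / i.factorial * (x - a) ^ i) +
      ∫ u in a..x, (x - u) ^ k / k.factorial * D (k + 1) u := by
  induction k with
  | zero => simpa using ((hD 0 (by simp)) x hx a ha).2
  | succ k ih =>
    rw [ih fun j hj => hD j (by omega), Finset.sum_range_succ _ (k + 1), add_assoc]
    congr 1
    have hφ : ∀ u : ℝ, HasDerivAt (fun u => (x - u) ^ (k + 1) / (k + 1).factorial)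
        (-((x - u) ^ k / k.factorial)) u := by
      intro u
      have h1 := (((hasDerivAt_id u).const_sub x).pow (k + 1)).div_const ((k + 1).factorial : ℝ)
      refine h1.congr_deriv ?_
      have : (k.factorial : ℝ) ≠ 0 := by positivity
      simp only [id, Nat.add_sub_cancel, Nat.factorial_succ]
      push_cast
      field_simp
    have := integral_mul_of_isPrimitive hJ (hD (k + 1) (by omega)) ha hx hφ (by fun_prop)
    rw [this]
    simp only [sub_self, neg_mul, intervalIntegral.integral_neg]
    ring

/-! ### Truncated powers -/

/-- The truncated power `(x - t)₊ⁱ / i!`, right-continuous also for `i = 0`. -/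
noncomputable def truncPow (i : ℕ) (t x : ℝ) : ℝ := if t ≤ x then (x - t) ^ i / i.factorial else 0

theorem truncPow_of_le {i : ℕ} {t x : ℝ} (h : t ≤ x) :
    truncPow i t x = (x - t) ^ i / i.factorial := if_pos h

theorem truncPow_of_lt {i : ℕ} {t x : ℝ} (h : x < t) : truncPow i t x = 0 := if_neg (not_le.2 h)

theorem truncPow_nonneg (i : ℕ) (t x : ℝ) : 0 ≤ truncPow i t x := by
  unfold truncPow
  split_ifs with h
  · have := sub_nonneg.2 h
    positivity
  · rfl

theorem truncPow_mono (i : ℕ) (t : ℝ) : Monotone (truncPow i t) := by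
  intro x y hxy
  rcases le_or_gt t x with h | h
  · rw [truncPow_of_le h, truncPow_of_le (h.trans hxy)]
    have := sub_nonneg.2 h
    gcongr
  · rw [truncPow_of_lt h]
    exact truncPow_nonneg i t y

theorem truncPow_eq_max {i : ℕ} (hi : i ≠ 0) (t x : ℝ) :
    truncPow i t x = max (x - t) 0 ^ i / i.factorial := by
  rcases le_or_gt t x with h | h
  · rw [truncPow_of_le h, max_eq_left (sub_nonneg.2 h)]
  · rw [truncPow_of_lt h, max_eq_right (by linarith), zero_pow hi, zero_div]

theorem continuous_truncPow {i : ℕ} (hi : i ≠ 0) (t : ℝ) : Continuous (truncPow i t) := by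
  have : truncPow i t = fun x => max (x - t) 0 ^ i / i.factorial :=
    funext (truncPow_eq_max hi t)
  rw [this]
  fun_prop

/-- Taking the derivative from the right covers the kink at `t` when `i = 0`, so one form of the
fundamental theorem of calculus serves every `i`. -/
theorem hasDerivWithinAt_truncPow (i : ℕ) (t x : ℝ) :
    HasDerivWithinAt (truncPow (i + 1) t) (truncPow i t x) (Ioi x) x := by
  rcases le_or_gt t x with h | h
  · have h1 : HasDerivAt (fun y => (y - t) ^ (i + 1) / (i + 1).factorial)
        ((x - t) ^ i / i.factorial) x := by
      have h1 := (((hasDerivAt_id x).sub_const t).pow (i + 1)).div_const ((i + 1).factorial : ℝ)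
      refine h1.congr_deriv ?_
      have : (i.factorial : ℝ) ≠ 0 := by positivity
      simp only [id, Nat.add_sub_cancel, Nat.factorial_succ]
      push_cast
      field_simp
    rw [truncPow_of_le h]
    refine h1.hasDerivWithinAt.congr (fun y hy => ?_) (truncPow_of_le h)
    exact truncPow_of_le (h.trans (le_of_lt hy))
  · rw [truncPow_of_lt h]
    have h1 : HasDerivAt (fun _ : ℝ => (0 : ℝ)) 0 x := hasDerivAt_const _ _
    refine (h1.congr_of_eventuallyEq ?_).hasDerivWithinAt
    filter_upwards [Iio_mem_nhds h] with y hy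
    exact truncPow_of_lt hy

theorem isPrimitive_truncPow (J : Set ℝ) (i : ℕ) (t : ℝ) :
    IsPrimitive J (truncPow (i + 1) t) (truncPow i t) := by
  intro x _ z _
  have hint : IntervalIntegrable (truncPow i t) volume z x :=
    ((truncPow_mono i t).monotoneOn _).intervalIntegrable
  refine ⟨hint, ?_⟩
  rw [intervalIntegral.integral_eq_sub_of_hasDeriv_right
    (continuous_truncPow (Nat.succ_ne_zero i) t).continuousOn
    (fun y _ => hasDerivWithinAt_truncPow i t y) hint]
  ring

/-! ### Layer-cake representation by truncated powers -/

/-- Let `x → -∞` in `∫ₓᵘ g = F u - F x`: `F` is nondecreasing because `g ≥ 0`, and its infimum is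
`0`, so no boundary term survives. -/
theorem lintegral_Iio_of_isPrimitive {J : Set ℝ} (hJ : IsLowerSet J) {F g : ℝ → ℝ}
    (hF : IsPrimitive J F g) (hF0 : ∀ x ∈ J, 0 ≤ F x) (hg0 : ∀ x ∈ J, 0 ≤ g x)
    (hinf : ∀ ε > 0, ∃ x ∈ J, F x < ε) {u : ℝ} (hu : u ∈ J) :
    ∫⁻ v in Iio u, ENNReal.ofReal (g v) = ENNReal.ofReal (F u) := by
  have hmono : ∀ x y, y ∈ J → x ≤ y → F x ≤ F y := by
    intro x y hy hxy
    rw [(hF y hy x (hJ hxy hy)).2]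
    have : 0 ≤ ∫ u in x..y, g u :=
      intervalIntegral.integral_nonneg hxy fun v hv => hg0 v (hJ hv.2 hy)
    linarith
  have hIoc : ∀ x ≤ u, ∫⁻ v in Ioc x u, ENNReal.ofReal (g v) = ENNReal.ofReal (F u - F x) := by
    intro x hx
    obtain ⟨hi, he⟩ := hF u hu x (hJ hx hu)
    rw [intervalIntegrable_iff_integrableOn_Ioc_of_le hx] at hi
    rw [he, add_sub_cancel_left, intervalIntegral.integral_of_le hx,
      ofReal_integral_eq_lintegral_ofReal hi]
    filter_upwards [ae_restrict_mem measurableSet_Ioc] with v hv using hg0 v (hJ hv.2 hu)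
  have hU : (⋃ n : ℕ, Ioc (u - n) u) = Iic u := by
    ext v
    simp only [mem_iUnion, mem_Ioc, mem_Iic]
    constructor
    · rintro ⟨_, h⟩
      exact h.2
    · intro h
      obtain ⟨n, hn⟩ := exists_nat_gt (u - v)
      exact ⟨n, by linarith, h⟩
  have hdir : Directed (· ⊆ ·) (fun n : ℕ => Ioc (u - n) u) :=
    Monotone.directed_le fun m n hmn => Ioc_subset_Ioc_left (by
      have : (m : ℝ) ≤ n := by exact_mod_cast hmn
      linarith)
  rw [setLIntegral_congr Iio_ae_eq_Iic, ← hU, setLIntegral_iUnion_of_directed _ hdir]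
  have hn : ∀ n : ℕ, u - (n : ℝ) ≤ u := fun n => by
    have : (0 : ℝ) ≤ n := n.cast_nonneg
    linarith
  simp only [fun n : ℕ => hIoc _ (hn n)]
  apply le_antisymm
  · refine iSup_le fun n => ENNReal.ofReal_le_ofReal ?_
    have := hF0 _ (hJ (hn n) hu)
    linarith
  · refine ENNReal.le_of_forall_pos_le_add fun ε hε _ => ?_
    obtain ⟨x, hxJ, hx⟩ := hinf ε hε
    obtain ⟨n, hn'⟩ := exists_nat_gt (u - x)
    have h1 : F (u - n) ≤ F x := hmono _ _ hxJ (by linarith)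
    calc ENNReal.ofReal (F u) ≤ ENNReal.ofReal ((F u - F (u - n)) + ε) :=
          ENNReal.ofReal_le_ofReal (by linarith)
      _ ≤ ENNReal.ofReal (F u - F (u - n)) + ENNReal.ofReal ε := ENNReal.ofReal_add_le
      _ ≤ _ := by
        rw [ENNReal.ofReal_coe_nnreal]
        gcongr
        exact le_iSup (fun n : ℕ => ENNReal.ofReal (F u - F (u - n))) n

/-- The `j`-fold iterated integral over `(-∞, u]` of the indicator of `{v | 0 < l < G v}`. -/
noncomputable def layer (G : ℝ → ℝ) : ℕ → ℝ → ℝ → ℝ≥0∞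
  | 0 => fun l v => {p : ℝ × ℝ | 0 < p.1 ∧ p.1 < G p.2}.indicator 1 (l, v)
  | j + 1 => fun l u => ∫⁻ v in Iio u, layer G j l v

theorem measurable_layer {G : ℝ → ℝ} (hG : Measurable G) (j : ℕ) :
    Measurable (Function.uncurry (layer G j)) := by
  induction j with
  | zero =>
    have : MeasurableSet {p : ℝ × ℝ | 0 < p.1 ∧ p.1 < G p.2} :=
      (measurableSet_lt measurable_const measurable_fst).inter
        (measurableSet_lt measurable_fst (hG.comp measurable_snd))
    exact measurable_one.indicator this
  | succ j ih =>
    have h1 : Measurable fun q : (ℝ × ℝ) × ℝ =>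
        {q : (ℝ × ℝ) × ℝ | q.2 < q.1.2}.indicator (fun q => layer G j q.1.1 q.2) q :=
      Measurable.indicator
        (ih.comp ((measurable_fst.comp measurable_fst).prodMk measurable_snd))
        (measurableSet_lt measurable_snd (measurable_snd.comp measurable_fst))
    have h2 := h1.lintegral_prod_right' (ν := (volume : Measure ℝ))
    convert h2 using 1
    ext ⟨l, u⟩
    simp only [Function.uncurry, layer]
    rw [← lintegral_indicator measurableSet_Iio]
    rfl

/-- Mixture representation: at `j = 0` it is the layer-cake formula, and each further integration
from `-∞` commutes with the integral over levels by Tonelli and lowers the order of the derivative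
by one. -/
theorem lintegral_layer {J : Set ℝ} (hJ : IsLowerSet J) {m : ℕ} {H : ℕ → ℝ → ℝ}
    (hH : ∀ i < m, IsPrimitive J (H i) (H (i + 1))) (hH0 : ∀ i ≤ m, ∀ x ∈ J, 0 ≤ H i x)
    (hinf : ∀ i ≤ m, ∀ ε > 0, ∃ x ∈ J, H i x < ε) {G : ℝ → ℝ} (hG : Measurable G)
    (hGH : EqOn G (H m) J) (j i : ℕ) (hij : i + j = m) {u : ℝ} (hu : u ∈ J) :
    ∫⁻ l, layer G j l u = ENNReal.ofReal (H i u) := by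
  induction j generalizing i u with
  | zero =>
    obtain rfl : i = m := hij
    have : (fun l => layer G 0 l u) = (Ioo 0 (G u)).indicator 1 := rfl
    rw [this, lintegral_indicator_one measurableSet_Ioo, Real.volume_Ioo, sub_zero, hGH hu]
  | succ j ih =>
    simp only [layer]
    rw [lintegral_lintegral_swap (measurable_layer hG j).aemeasurable,
      ← lintegral_Iio_of_isPrimitive hJ (hH i (by omega)) (hH0 i (by omega))
        (hH0 (i + 1) (by omega)) (hinf i (by omega)) hu]
    refine setLIntegral_congr_fun measurableSet_Iio fun v hv => ?_
    exact ih (i + 1) (by omega) (hJ (le_of_lt hv) hu)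

theorem lintegral_Iio_truncPow (i : ℕ) (t u : ℝ) :
    ∫⁻ v in Iio u, ENNReal.ofReal (truncPow i t v) = ENNReal.ofReal (truncPow (i + 1) t u) :=
  lintegral_Iio_of_isPrimitive isLowerSet_univ (isPrimitive_truncPow univ i t)
    (fun x _ => truncPow_nonneg _ t x) (fun x _ => truncPow_nonneg _ t x)
    (fun ε hε => ⟨t - 1, mem_univ _, by rwa [truncPow_of_lt (by linarith)]⟩) (mem_univ u)

/-- A nonempty superlevel set of a monotone function is an upper ray of `J`, and `t` is its infimum;
`hinf` bounds it below. Whether the ray contains `t` is unknown, hence the exception `u = t`, a null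
set for later integrations. -/
theorem layer_eq_zero_or_truncPow {J : Set ℝ} (hJ : IsLowerSet J) {G : ℝ → ℝ}
    (hG : MonotoneOn G J) (hinf : ∀ ε > 0, ∃ x ∈ J, G x < ε) (l : ℝ) :
    (∀ j, ∀ u ∈ J, layer G j l u = 0) ∨
      ∃ t ∈ J, ∀ j, ∀ u ∈ J, u ≠ t → layer G j l u = ENNReal.ofReal (truncPow j t u) := by
  by_cases hS : ∃ s ∈ J, 0 < l ∧ l < G s
  · right
    obtain ⟨s, hsJ, hl, hs⟩ := hS
    obtain ⟨x, hxJ, hx⟩ := hinf l hl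
    set S : Set ℝ := {v | v ∈ J ∧ l < G v} with hSdef
    have hbdd : BddBelow S := by
      refine ⟨x, fun v hv => ?_⟩
      by_contra! h
      exact absurd (hG hv.1 hxJ h.le) (not_le.2 (hx.trans hv.2))
    have hne : S.Nonempty := ⟨s, hsJ, hs⟩
    refine ⟨sInf S, hJ (csInf_le hbdd ⟨hsJ, hs⟩) hsJ, fun j => ?_⟩
    induction j with
    | zero =>
      intro u hu hut
      simp only [layer, indicator, mem_ofPred_eq, hl, true_and]
      rcases lt_or_gt_of_ne hut with h | h
      · rw [truncPow_of_lt h, if_neg, ENNReal.ofReal_zero]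
        exact fun h' => absurd (csInf_le hbdd ⟨hu, h'⟩) (not_le.2 h)
      · obtain ⟨v, hv, hvu⟩ := (csInf_lt_iff hbdd hne).1 h
        rw [truncPow_of_le h.le, if_pos (hv.2.trans_le (hG hv.1 hu hvu.le))]
        simp
    | succ j ih =>
      intro u hu _
      rw [← lintegral_Iio_truncPow]
      simp only [layer]
      refine setLIntegral_congr_fun_ae measurableSet_Iio ?_
      filter_upwards [Measure.ae_ne volume (sInf S)] with v hv hvu
      exact ih v (hJ (le_of_lt hvu) hu) hv
  · left
    push Not at hS
    intro j
    induction j with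
    | zero =>
      intro u hu
      simp only [layer]
      exact indicator_of_notMem (fun h => absurd h.2 (not_lt.2 (hS u hu h.1))) _
    | succ j ih =>
      intro u hu
      simp only [layer]
      rw [setLIntegral_congr_fun measurableSet_Iio fun v hv => ih v (hJ (le_of_lt hv) hu)]
      simp

theorem measurable_indicator_of_monotoneOn {J : Set ℝ} (hJ : IsLowerSet J) {H : ℝ → ℝ}
    (hH : MonotoneOn H J) (hH0 : ∀ x ∈ J, 0 ≤ H x) : Measurable (J.indicator H) := by
  have hJo : J.OrdConnected := hJ.ordConnected
  refine measurable_of_Ioi fun c => ?_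
  by_cases hc : 0 ≤ c
  · have : J.indicator H ⁻¹' Ioi c = {x | x ∈ J ∧ c < H x} := by
      ext x
      by_cases hx : x ∈ J <;> simp [hx, hc]
    rw [this]
    refine Set.OrdConnected.measurableSet ⟨fun x hx y hy v hv => ?_⟩
    have hvJ := hJ hv.2 hy.1
    exact ⟨hvJ, hx.2.trans_le (hH hx.1 hvJ hv.1)⟩
  · have : J.indicator H ⁻¹' Ioi c = univ := by
      ext x
      push Not at hc
      by_cases hx : x ∈ J
      · simpa [hx] using hc.trans_le (hH0 x hx)
      · simpa [hx] using hc
    rw [this]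
    exact MeasurableSet.univ

/-! ### The signed Taylor kernel -/

/-- The signed kernel with `∫ u in a..x, (x - u)ᵏ / k! * h u = ∫ u, taylorKernel k a x u * h u`. -/
noncomputable def taylorKernel (k : ℕ) (a x u : ℝ) : ℝ :=
  (x - u) ^ k / k.factorial * ((if a < u ∧ u ≤ x then 1 else 0) - if x < u ∧ u ≤ a then 1 else 0)

/-- The integral against the positive part of the Taylor kernel. -/
noncomputable def taylorPos (k : ℕ) (a : ℝ) (g : ℝ → ℝ≥0∞) (x : ℝ) : ℝ≥0∞ :=
  ∫⁻ u, ENNReal.ofReal (taylorKernel k a x u) * g u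

/-- The integral against the negative part of the Taylor kernel. -/
noncomputable def taylorNeg (k : ℕ) (a : ℝ) (g : ℝ → ℝ≥0∞) (x : ℝ) : ℝ≥0∞ :=
  ∫⁻ u, ENNReal.ofReal (-taylorKernel k a x u) * g u

theorem measurable_taylorKernel (k : ℕ) (a : ℝ) :
    Measurable (Function.uncurry (taylorKernel k a)) := by
  unfold taylorKernel
  refine Measurable.mul (by fun_prop) (Measurable.sub ?_ ?_)
  · refine Measurable.ite ?_ measurable_const measurable_const
    exact (measurableSet_lt measurable_const measurable_snd).inter
      (measurableSet_le measurable_snd measurable_fst)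
  · refine Measurable.ite ?_ measurable_const measurable_const
    exact (measurableSet_lt measurable_fst measurable_snd).inter
      (measurableSet_le measurable_snd measurable_const)

theorem taylorKernel_eq_zero {k : ℕ} {a x u : ℝ} (h : u ∉ uIoc a x) :
    taylorKernel k a x u = 0 := by
  rw [mem_uIoc, not_or] at h
  rw [taylorKernel, if_neg h.1, if_neg h.2]
  ring

theorem taylorKernel_mul_eq (k : ℕ) (a x : ℝ) (h : ℝ → ℝ) :
    (fun u => taylorKernel k a x u * h u) = fun u =>
      (Ioc a x).indicator (fun u => (x - u) ^ k / k.factorial * h u) u -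
        (Ioc x a).indicator (fun u => (x - u) ^ k / k.factorial * h u) u := by
  ext u
  simp only [taylorKernel, indicator, mem_Ioc]
  split_ifs <;> ring

/-- The kernel vanishes off the segment from `a` to `x`, which lies in `J`, so only values on `J`
matter. An almost everywhere hypothesis on `g` suffices and absorbs the exceptional endpoint of a
layer. -/
theorem taylorPos_sub_taylorNeg {J : Set ℝ} (hJ : J.OrdConnected) (k : ℕ) {a x : ℝ} (ha : a ∈ J)
    (hx : x ∈ J) {h : ℝ → ℝ} (hh : ∀ u ∈ J, 0 ≤ h u) (hint : IntervalIntegrable h volume a x)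
    {g : ℝ → ℝ≥0∞} (hg : ∀ᵐ u, u ∈ J → g u = ENNReal.ofReal (h u)) :
    taylorPos k a g x ≠ ⊤ ∧ taylorNeg k a g x ≠ ⊤ ∧
      (taylorPos k a g x).toReal - (taylorNeg k a g x).toReal =
        ∫ u in a..x, (x - u) ^ k / k.factorial * h u := by
  have hint' : IntervalIntegrable (fun u => (x - u) ^ k / k.factorial * h u) volume a x :=
    hint.continuousOn_mul (by fun_prop)
  have i1 := hint'.1.integrable_indicator measurableSet_Ioc
  have i2 := hint'.2.integrable_indicator measurableSet_Ioc
  have hI : Integrable (fun u => taylorKernel k a x u * h u) := by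
    rw [taylorKernel_mul_eq]
    exact i1.sub i2
  have e0 : ∫ u, taylorKernel k a x u * h u = ∫ u in a..x, (x - u) ^ k / k.factorial * h u := by
    rw [taylorKernel_mul_eq, integral_sub i1 i2, integral_indicator measurableSet_Ioc,
      integral_indicator measurableSet_Ioc, intervalIntegral]
  have hmem : ∀ u, u ∉ J → taylorKernel k a x u = 0 := fun u hu =>
    taylorKernel_eq_zero fun hu' => hu (hJ.uIcc_subset ha hx (uIoc_subset_uIcc hu'))
  have e1 : taylorPos k a g x = ∫⁻ u, ENNReal.ofReal (taylorKernel k a x u * h u) := by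
    refine lintegral_congr_ae ?_
    filter_upwards [hg] with u hu
    by_cases huJ : u ∈ J
    · rw [hu huJ, ENNReal.ofReal_mul' (hh u huJ)]
    · simp [hmem u huJ]
  have e2 : taylorNeg k a g x = ∫⁻ u, ENNReal.ofReal (-(taylorKernel k a x u * h u)) := by
    refine lintegral_congr_ae ?_
    filter_upwards [hg] with u hu
    by_cases huJ : u ∈ J
    · rw [hu huJ, ← neg_mul, ENNReal.ofReal_mul' (hh u huJ)]
    · simp [hmem u huJ]
  refine ⟨?_, ?_, ?_⟩
  · rw [e1]
    exact hI.lintegral_lt_top.ne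
  · rw [e2]
    exact hI.neg.lintegral_lt_top.ne
  · rw [e1, e2, ← e0, integral_eq_lintegral_pos_part_sub_lintegral_neg_part hI]

theorem integral_sub_pow_div_factorial (k : ℕ) (a x : ℝ) :
    ∫ u in a..x, (x - u) ^ k / k.factorial = (x - a) ^ (k + 1) / (k + 1).factorial := by
  have h0 : (k.factorial : ℝ) ≠ 0 := by positivity
  rw [intervalIntegral.integral_div, intervalIntegral.integral_comp_sub_left (fun y => y ^ k),
    integral_pow, sub_self, Nat.factorial_succ]
  push_cast
  field_simp
  simp

theorem taylorKernel_nonneg_or {k : ℕ} {a x u : ℝ} : 0 ≤ taylorKernel k a x u ∨ x < u ∧ u ≤ a := by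
  rw [or_iff_not_imp_right]
  intro h
  rw [taylorKernel, if_neg h, sub_zero]
  split_ifs with h'
  · have := sub_nonneg.2 h'.2
    positivity
  · simp

/-- For fixed `a` and `x` the kernel has constant sign. If it is negative somewhere, then `x < a`
and `k` is even, its positive part vanishes, and its total integral is `(x - a)ᵏ⁺¹ / (k + 1)!`. -/
theorem taylorNeg_one_le (k : ℕ) (a x : ℝ) :
    taylorNeg k a (fun _ => 1) x ≤ ENNReal.ofReal (-(x - a) ^ (k + 1) / (k + 1).factorial) := by
  by_cases h0 : ∀ u, 0 ≤ taylorKernel k a x u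
  · have : taylorNeg k a (fun _ => 1) x = 0 := by
      simp [taylorNeg, ENNReal.ofReal_eq_zero.2 (neg_nonpos.2 (h0 _))]
    simp [this]
  · have hle : ∀ u, taylorKernel k a x u ≤ 0 := by
      push Not at h0
      obtain ⟨v, hv⟩ := h0
      obtain ⟨hv1, hv2⟩ := taylorKernel_nonneg_or.resolve_left (not_le.2 hv)
      have hxa : x < a := hv1.trans_le hv2
      have hform : ∀ u, x < u ∧ u ≤ a → taylorKernel k a x u = -((x - u) ^ k / k.factorial) := by
        intro u hu
        rw [taylorKernel, if_pos hu, if_neg fun h => by linarith [h.1, h.2]]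
        ring
      have hk : Even k := by
        by_contra hk
        rw [Nat.not_even_iff_odd] at hk
        rw [hform v ⟨hv1, hv2⟩] at hv
        have := hk.pow_neg (sub_neg.2 hv1)
        have : (x - v) ^ k / k.factorial < 0 := div_neg_of_neg_of_pos this (by positivity)
        linarith
      intro u
      by_cases hu : x < u ∧ u ≤ a
      · rw [hform u hu]
        have := hk.pow_nonneg (x - u)
        have : 0 ≤ (x - u) ^ k / k.factorial := by positivity
        linarith
      · refine (taylorKernel_eq_zero ?_).le
        rw [mem_uIoc, not_or]
        exact ⟨fun h => by linarith [h.1, h.2], hu⟩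
    obtain ⟨h1, h2, h3⟩ := taylorPos_sub_taylorNeg (J := univ) ordConnected_univ k (mem_univ a)
      (mem_univ x) (h := fun _ => 1) (fun _ _ => zero_le_one) (by simp) (g := fun _ => 1)
      (by simp)
    have hz : taylorPos k a (fun _ => 1) x = 0 := by
      simp [taylorPos, ENNReal.ofReal_eq_zero.2 (hle _)]
    simp only [mul_one, integral_sub_pow_div_factorial, hz, ENNReal.toReal_zero] at h3
    rw [← ENNReal.ofReal_toReal h2]
    apply ENNReal.ofReal_le_ofReal
    rw [neg_div, ← h3]
    simp

/-- The kernel can be negative only at points `u ≤ a`, where monotonicity bounds `g u` by `g a`. -/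
theorem taylorNeg_le {J : Set ℝ} (hJ : IsLowerSet J) (k : ℕ) {a : ℝ} (ha : a ∈ J)
    {g : ℝ → ℝ≥0∞} (hg : MonotoneOn g J) (x : ℝ) :
    taylorNeg k a g x ≤ ENNReal.ofReal (-(x - a) ^ (k + 1) / (k + 1).factorial) * g a := by
  calc taylorNeg k a g x ≤ ∫⁻ u, ENNReal.ofReal (-taylorKernel k a x u) * g a := by
        refine lintegral_mono fun u => ?_
        rcases taylorKernel_nonneg_or (k := k) (a := a) (x := x) (u := u) with h | h
        · simp [ENNReal.ofReal_eq_zero.2 (neg_nonpos.2 h)]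
        · gcongr
          exact hg (hJ h.2 ha) ha h.2
    _ = taylorNeg k a (fun _ => 1) x * g a := by
        rw [lintegral_mul_const]
        · simp [taylorNeg]
        · exact ((measurable_taylorKernel k a).comp measurable_prodMk_left).neg.ennreal_ofReal
    _ ≤ _ := by
        gcongr
        exact taylorNeg_one_le k a x

theorem taylorPos_lintegral {A : ℝ → ℝ → ℝ≥0∞} (hA : Measurable (Function.uncurry A)) (k : ℕ)
    (a x : ℝ) : taylorPos k a (fun u => ∫⁻ l, A l u) x = ∫⁻ l, taylorPos k a (A l) x := by
  have hm : Measurable fun u => ENNReal.ofReal (taylorKernel k a x u) :=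
    ((measurable_taylorKernel k a).comp measurable_prodMk_left).ennreal_ofReal
  unfold taylorPos
  rw [lintegral_lintegral_swap]
  · refine lintegral_congr fun u => ?_
    exact (lintegral_const_mul _ (hA.comp (measurable_id.prodMk measurable_const))).symm
  · exact ((hm.comp measurable_snd).mul hA).aemeasurable

theorem taylorNeg_lintegral {A : ℝ → ℝ → ℝ≥0∞} (hA : Measurable (Function.uncurry A)) (k : ℕ)
    (a x : ℝ) : taylorNeg k a (fun u => ∫⁻ l, A l u) x = ∫⁻ l, taylorNeg k a (A l) x := by
  have hm : Measurable fun u => ENNReal.ofReal (-taylorKernel k a x u) :=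
    ((measurable_taylorKernel k a).comp measurable_prodMk_left).neg.ennreal_ofReal
  unfold taylorNeg
  rw [lintegral_lintegral_swap]
  · refine lintegral_congr fun u => ?_
    exact (lintegral_const_mul _ (hA.comp (measurable_id.prodMk measurable_const))).symm
  · exact ((hm.comp measurable_snd).mul hA).aemeasurable

theorem measurable_taylorPos {A : ℝ → ℝ → ℝ≥0∞} (hA : Measurable (Function.uncurry A)) (k : ℕ)
    (a : ℝ) : Measurable (Function.uncurry fun l x => taylorPos k a (A l) x) := by
  refine Measurable.lintegral_prod_right' (ν := (volume : Measure ℝ))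
    (f := fun q : (ℝ × ℝ) × ℝ => ENNReal.ofReal (taylorKernel k a q.1.2 q.2) * A q.1.1 q.2) ?_
  exact ((measurable_taylorKernel k a).comp
    ((measurable_snd.comp measurable_fst).prodMk measurable_snd)).ennreal_ofReal.mul
      (hA.comp ((measurable_fst.comp measurable_fst).prodMk measurable_snd))

theorem measurable_taylorNeg {A : ℝ → ℝ → ℝ≥0∞} (hA : Measurable (Function.uncurry A)) (k : ℕ)
    (a : ℝ) : Measurable (Function.uncurry fun l x => taylorNeg k a (A l) x) := by
  refine Measurable.lintegral_prod_right' (ν := (volume : Measure ℝ))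
    (f := fun q : (ℝ × ℝ) × ℝ => ENNReal.ofReal (-taylorKernel k a q.1.2 q.2) * A q.1.1 q.2) ?_
  exact ((measurable_taylorKernel k a).comp
    ((measurable_snd.comp measurable_fst).prodMk measurable_snd)).neg.ennreal_ofReal.mul
      (hA.comp ((measurable_fst.comp measurable_fst).prodMk measurable_snd))

/-! ### Comparison of extended expectations -/

section Compare

variable {α : Type*} [MeasurableSpace α] {P Q : Measure α}

/-- `f = p - q` almost everywhere, with `p`, `q` nonnegative and finite and `q` integrable. -/
structure IsPosNegRep (P : Measure α) (f : α → ℝ) (p q : α → ℝ≥0∞) : Prop where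
  aemeasurable_pos : AEMeasurable p P
  aemeasurable_neg : AEMeasurable q P
  lintegral_neg : ∫⁻ x, q x ∂P ≠ ⊤
  ae_eq : ∀ᵐ x ∂P, p x ≠ ⊤ ∧ q x ≠ ⊤ ∧ f x = (p x).toReal - (q x).toReal

theorem IsPosNegRep.of_aemeasurable {f : α → ℝ} (hf : AEMeasurable f P)
    (hn : ∫⁻ x, ENNReal.ofReal (-f x) ∂P ≠ ⊤) :
    IsPosNegRep P f (fun x => ENNReal.ofReal (f x)) (fun x => ENNReal.ofReal (-f x)) where
  aemeasurable_pos := hf.ennreal_ofReal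
  aemeasurable_neg := hf.neg.ennreal_ofReal
  lintegral_neg := hn
  ae_eq := Filter.Eventually.of_forall fun x => by
    refine ⟨ENNReal.ofReal_ne_top, ENNReal.ofReal_ne_top, ?_⟩
    rw [ENNReal.toReal_ofReal', ENNReal.toReal_ofReal', max_zero_sub_eq_self]

theorem IsPosNegRep.aemeasurable {f : α → ℝ} {p q : α → ℝ≥0∞} (h : IsPosNegRep P f p q) :
    AEMeasurable f P :=
  (h.aemeasurable_pos.ennreal_toReal.sub h.aemeasurable_neg.ennreal_toReal).congr <| by
    filter_upwards [h.ae_eq] with x hx using hx.2.2.symm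

theorem IsPosNegRep.lintegral_ofReal_neg_ne_top {f : α → ℝ} {p q : α → ℝ≥0∞}
    (h : IsPosNegRep P f p q) : ∫⁻ x, ENNReal.ofReal (-f x) ∂P ≠ ⊤ := by
  refine ne_top_of_le_ne_top h.lintegral_neg (lintegral_mono_ae ?_)
  filter_upwards [h.ae_eq] with x hx
  rw [hx.2.2]
  apply ENNReal.ofReal_le_of_le_toReal
  have := ENNReal.toReal_nonneg (a := p x)
  linarith

theorem IsPosNegRep.lintegral_add_eq {f : α → ℝ} {p q p' q' : α → ℝ≥0∞}
    (h : IsPosNegRep P f p q) (h' : IsPosNegRep P f p' q') :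
    ∫⁻ x, p x ∂P + ∫⁻ x, q' x ∂P = ∫⁻ x, p' x ∂P + ∫⁻ x, q x ∂P := by
  rw [← lintegral_add_left' h.aemeasurable_pos, ← lintegral_add_left' h'.aemeasurable_pos]
  refine lintegral_congr_ae ?_
  filter_upwards [h.ae_eq, h'.ae_eq] with x hx hx'
  rw [← ENNReal.toReal_eq_toReal_iff' (by simp [hx.1, hx'.2.1]) (by simp [hx'.1, hx.2.1]),
    ENNReal.toReal_add hx.1 hx'.2.1, ENNReal.toReal_add hx'.1 hx.2.1]
  linarith [hx.2.2, hx'.2.2]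

theorem IsPosNegRep.add {f g : α → ℝ} {p q p' q' : α → ℝ≥0∞}
    (h : IsPosNegRep P f p q) (h' : IsPosNegRep P g p' q') :
    IsPosNegRep P (fun x => f x + g x) (fun x => p x + p' x) (fun x => q x + q' x) where
  aemeasurable_pos := h.aemeasurable_pos.add h'.aemeasurable_pos
  aemeasurable_neg := h.aemeasurable_neg.add h'.aemeasurable_neg
  lintegral_neg := by
    rw [lintegral_add_left' h.aemeasurable_neg]
    exact ENNReal.add_ne_top.2 ⟨h.lintegral_neg, h'.lintegral_neg⟩
  ae_eq := by
    filter_upwards [h.ae_eq, h'.ae_eq] with x hx hx'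
    refine ⟨ENNReal.add_ne_top.2 ⟨hx.1, hx'.1⟩, ENNReal.add_ne_top.2 ⟨hx.2.1, hx'.2.1⟩, ?_⟩
    rw [ENNReal.toReal_add hx.1 hx'.1, ENNReal.toReal_add hx.2.1 hx'.2.1, hx.2.2, hx'.2.2]
    ring

/-- `-∞ < ∫ f ∂Q ≤ ∫ f ∂P` in the extended sense. -/
structure ExpLE (Q P : Measure α) (f : α → ℝ) : Prop where
  aemeasurable_left : AEMeasurable f Q
  aemeasurable_right : AEMeasurable f P
  neg_left : ∫⁻ x, ENNReal.ofReal (-f x) ∂Q ≠ ⊤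
  neg_right : ∫⁻ x, ENNReal.ofReal (-f x) ∂P ≠ ⊤
  le : ∫⁻ x, ENNReal.ofReal (f x) ∂Q + ∫⁻ x, ENNReal.ofReal (-f x) ∂P ≤
    ∫⁻ x, ENNReal.ofReal (f x) ∂P + ∫⁻ x, ENNReal.ofReal (-f x) ∂Q

theorem ExpLE.repLeft {f : α → ℝ} (h : ExpLE Q P f) :
    IsPosNegRep Q f (fun x => ENNReal.ofReal (f x)) (fun x => ENNReal.ofReal (-f x)) :=
  .of_aemeasurable h.aemeasurable_left h.neg_left

theorem ExpLE.repRight {f : α → ℝ} (h : ExpLE Q P f) :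
    IsPosNegRep P f (fun x => ENNReal.ofReal (f x)) (fun x => ENNReal.ofReal (-f x)) :=
  .of_aemeasurable h.aemeasurable_right h.neg_right

/-- The comparison does not depend on the chosen decomposition: add the finite integrals of `q` to
both sides, exchange decompositions, and cancel. -/
theorem lintegral_add_le_of_isPosNegRep {f : α → ℝ} {p q p' q' : α → ℝ≥0∞}
    (hQ : IsPosNegRep Q f p q) (hP : IsPosNegRep P f p q)
    (hQ' : IsPosNegRep Q f p' q') (hP' : IsPosNegRep P f p' q')
    (h : ∫⁻ x, p x ∂Q + ∫⁻ x, q x ∂P ≤ ∫⁻ x, p x ∂P + ∫⁻ x, q x ∂Q) :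
    ∫⁻ x, p' x ∂Q + ∫⁻ x, q' x ∂P ≤ ∫⁻ x, p' x ∂P + ∫⁻ x, q' x ∂Q := by
  have e1 := hQ.lintegral_add_eq hQ'
  have e2 := hP.lintegral_add_eq hP'
  have hfin : ∫⁻ x, q x ∂Q + ∫⁻ x, q x ∂P ≠ ⊤ :=
    ENNReal.add_ne_top.2 ⟨hQ.lintegral_neg, hP.lintegral_neg⟩
  rw [← ENNReal.add_le_add_iff_right hfin]
  calc ∫⁻ x, p' x ∂Q + ∫⁻ x, q' x ∂P + (∫⁻ x, q x ∂Q + ∫⁻ x, q x ∂P)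
      = (∫⁻ x, p' x ∂Q + ∫⁻ x, q x ∂Q) + (∫⁻ x, q' x ∂P + ∫⁻ x, q x ∂P) := by ring
    _ = (∫⁻ x, p x ∂Q + ∫⁻ x, q x ∂P) + (∫⁻ x, q' x ∂Q + ∫⁻ x, q' x ∂P) := by
        rw [← e1]
        ring
    _ ≤ (∫⁻ x, p x ∂P + ∫⁻ x, q x ∂Q) + (∫⁻ x, q' x ∂Q + ∫⁻ x, q' x ∂P) := by gcongr
    _ = (∫⁻ x, p x ∂P + ∫⁻ x, q' x ∂P) + (∫⁻ x, q x ∂Q + ∫⁻ x, q' x ∂Q) := by ring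
    _ = _ := by
        rw [e2]
        ring

theorem ExpLE.of_isPosNegRep {f : α → ℝ} {p q : α → ℝ≥0∞}
    (hQ : IsPosNegRep Q f p q) (hP : IsPosNegRep P f p q)
    (h : ∫⁻ x, p x ∂Q + ∫⁻ x, q x ∂P ≤ ∫⁻ x, p x ∂P + ∫⁻ x, q x ∂Q) : ExpLE Q P f where
  aemeasurable_left := hQ.aemeasurable
  aemeasurable_right := hP.aemeasurable
  neg_left := hQ.lintegral_ofReal_neg_ne_top
  neg_right := hP.lintegral_ofReal_neg_ne_top
  le := lintegral_add_le_of_isPosNegRep hQ hP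
    (.of_aemeasurable hQ.aemeasurable hQ.lintegral_ofReal_neg_ne_top)
    (.of_aemeasurable hP.aemeasurable hP.lintegral_ofReal_neg_ne_top) h

theorem ExpLE.lintegral_add_le {f : α → ℝ} (h : ExpLE Q P f) {p q : α → ℝ≥0∞}
    (hQ : IsPosNegRep Q f p q) (hP : IsPosNegRep P f p q) :
    ∫⁻ x, p x ∂Q + ∫⁻ x, q x ∂P ≤ ∫⁻ x, p x ∂P + ∫⁻ x, q x ∂Q :=
  lintegral_add_le_of_isPosNegRep h.repLeft h.repRight hQ hP h.le

theorem ExpLE.add {f g : α → ℝ} (hf : ExpLE Q P f) (hg : ExpLE Q P g) :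
    ExpLE Q P fun x => f x + g x := by
  refine .of_isPosNegRep (hf.repLeft.add hg.repLeft) (hf.repRight.add hg.repRight) ?_
  rw [lintegral_add_left' hf.repLeft.aemeasurable_pos,
    lintegral_add_left' hf.repLeft.aemeasurable_neg,
    lintegral_add_left' hf.repRight.aemeasurable_pos,
    lintegral_add_left' hf.repRight.aemeasurable_neg]
  calc _ = (∫⁻ x, ENNReal.ofReal (f x) ∂Q + ∫⁻ x, ENNReal.ofReal (-f x) ∂P) +
        (∫⁻ x, ENNReal.ofReal (g x) ∂Q + ∫⁻ x, ENNReal.ofReal (-g x) ∂P) := by ring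
    _ ≤ _ := add_le_add hf.le hg.le
    _ = _ := by ring

theorem ExpLE.const_mul {f : α → ℝ} (hf : ExpLE Q P f) {c : ℝ} (hc : 0 ≤ c) :
    ExpLE Q P fun x => c * f x := by
  have h1 : ∀ ρ : Measure α, AEMeasurable f ρ → ∫⁻ x, ENNReal.ofReal (c * f x) ∂ρ =
      ENNReal.ofReal c * ∫⁻ x, ENNReal.ofReal (f x) ∂ρ := fun ρ hR => by
    simp only [ENNReal.ofReal_mul hc]
    rw [lintegral_const_mul'' _ hR.ennreal_ofReal]
  have h2 : ∀ ρ : Measure α, AEMeasurable f ρ → ∫⁻ x, ENNReal.ofReal (-(c * f x)) ∂ρ =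
      ENNReal.ofReal c * ∫⁻ x, ENNReal.ofReal (-f x) ∂ρ := fun ρ hR => by
    simp only [← mul_neg, ENNReal.ofReal_mul hc]
    exact lintegral_const_mul'' _ hR.neg.ennreal_ofReal
  refine ⟨hf.aemeasurable_left.const_mul c, hf.aemeasurable_right.const_mul c, ?_, ?_, ?_⟩
  · rw [h2 Q hf.aemeasurable_left]
    exact ENNReal.mul_ne_top ENNReal.ofReal_ne_top hf.neg_left
  · rw [h2 P hf.aemeasurable_right]
    exact ENNReal.mul_ne_top ENNReal.ofReal_ne_top hf.neg_right
  · rw [h1 Q hf.aemeasurable_left, h1 P hf.aemeasurable_right, h2 Q hf.aemeasurable_left,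
      h2 P hf.aemeasurable_right, ← mul_add, ← mul_add]
    exact mul_le_mul' le_rfl hf.le

theorem ExpLE.congr {f g : α → ℝ} (hf : ExpLE Q P f) (hQ : f =ᵐ[Q] g) (hP : f =ᵐ[P] g) :
    ExpLE Q P g := by
  have e1 : ∀ {ρ : Measure α}, f =ᵐ[ρ] g →
      ∫⁻ x, ENNReal.ofReal (f x) ∂ρ = ∫⁻ x, ENNReal.ofReal (g x) ∂ρ := fun hR =>
    lintegral_congr_ae (hR.mono fun x hx => by simp only [hx])
  have e2 : ∀ {ρ : Measure α}, f =ᵐ[ρ] g →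
      ∫⁻ x, ENNReal.ofReal (-f x) ∂ρ = ∫⁻ x, ENNReal.ofReal (-g x) ∂ρ := fun hR =>
    lintegral_congr_ae (hR.mono fun x hx => by simp only [hx])
  exact ⟨hf.aemeasurable_left.congr hQ, hf.aemeasurable_right.congr hP, e2 hQ ▸ hf.neg_left,
    e2 hP ▸ hf.neg_right, by rw [← e1 hQ, ← e1 hP, ← e2 hQ, ← e2 hP]; exact hf.le⟩

/-- `f` is integrable with the same integral under `P` and `Q`. -/
structure SameExp (Q P : Measure α) (f : α → ℝ) : Prop where
  integrable_left : Integrable f Q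
  integrable_right : Integrable f P
  eq : ∫ x, f x ∂Q = ∫ x, f x ∂P

theorem SameExp.add {f g : α → ℝ} (hf : SameExp Q P f) (hg : SameExp Q P g) :
    SameExp Q P fun x => f x + g x :=
  ⟨hf.1.add hg.1, hf.2.add hg.2, by
    rw [integral_add hf.1 hg.1, integral_add hf.2 hg.2, hf.3, hg.3]⟩

theorem SameExp.const_mul {f : α → ℝ} (hf : SameExp Q P f) (c : ℝ) :
    SameExp Q P fun x => c * f x :=
  ⟨hf.1.const_mul c, hf.2.const_mul c, by rw [integral_const_mul, integral_const_mul, hf.3]⟩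

theorem SameExp.sum {ι : Type*} {s : Finset ι} {f : ι → α → ℝ}
    (hf : ∀ i ∈ s, SameExp Q P (f i)) : SameExp Q P fun x => ∑ i ∈ s, f i x :=
  ⟨integrable_finsetSum _ fun i hi => (hf i hi).1, integrable_finsetSum _ fun i hi => (hf i hi).2,
    by
      rw [integral_finsetSum _ fun i hi => (hf i hi).1, integral_finsetSum _ fun i hi => (hf i hi).2]
      exact Finset.sum_congr rfl fun i hi => (hf i hi).3⟩

theorem SameExp.expLE {f : α → ℝ} (hf : SameExp Q P f) : ExpLE Q P f := by
  have hQ : ∫⁻ x, ENNReal.ofReal (-f x) ∂Q ≠ ⊤ := hf.1.neg.lintegral_lt_top.ne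
  have hP : ∫⁻ x, ENNReal.ofReal (-f x) ∂P ≠ ⊤ := hf.2.neg.lintegral_lt_top.ne
  refine ⟨hf.1.aemeasurable, hf.2.aemeasurable, hQ, hP, ?_⟩
  have h := hf.3
  rw [integral_eq_lintegral_pos_part_sub_lintegral_neg_part hf.1,
    integral_eq_lintegral_pos_part_sub_lintegral_neg_part hf.2] at h
  have hQ' := hf.1.lintegral_lt_top.ne
  have hP' := hf.2.lintegral_lt_top.ne
  rw [← ENNReal.toReal_le_toReal (ENNReal.add_ne_top.2 ⟨hQ', hP⟩)
    (ENNReal.add_ne_top.2 ⟨hP', hQ⟩), ENNReal.toReal_add hQ' hP, ENNReal.toReal_add hP' hQ]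
  linarith

end Compare

/-! ### Comparison on the cone `FPlus` -/

theorem sub_pow_eq_sum (x b b' : ℝ) (i : ℕ) : (x - b') ^ i =
    ∑ j ∈ Finset.range (i + 1), ((b - b') ^ (i - j) * i.choose j) * (x - b) ^ j := by
  rw [← sub_add_sub_cancel x b b', add_pow]
  exact Finset.sum_congr rfl fun j _ => by ring

theorem SameExp.sub_pow {Q P : Measure ℝ} {k : ℕ} {b : ℝ}
    (h : ∀ i < k, SameExp Q P fun x => (x - b) ^ i) (b' : ℝ) (i : ℕ) (hi : i < k) :
    SameExp Q P fun x => (x - b') ^ i := by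
  rw [funext fun x => sub_pow_eq_sum x b b' i]
  exact SameExp.sum fun j hj => (h j (by have := Finset.mem_range.1 hj; omega)).const_mul _

/-- Recentring keeps the leading coefficient `1` and changes only lower-order terms, whose
expectations agree. -/
theorem ExpLE.sub_pow {Q P : Measure ℝ} {k : ℕ} {b b' : ℝ}
    (h : ∀ i < k, SameExp Q P fun x => (x - b) ^ i) (hk : ExpLE Q P fun x => (x - b) ^ k) :
    ExpLE Q P fun x => (x - b') ^ k := by
  rw [funext fun x => (sub_pow_eq_sum x b b' k).trans (Finset.sum_range_succ _ k)]
  refine ExpLE.add (SameExp.sum fun j hj => (h j (Finset.mem_range.1 hj)).const_mul _).expLE ?_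
  simpa using hk

section Core

variable {J : Set ℝ} {Q P : Measure ℝ} {k m : ℕ} {a : ℝ}

/-- By Taylor's formula the integral is `truncPow (k + 1 + m) t x` minus a polynomial in `x` of
degree at most `k`, whose expectations coincide. -/
theorem expLE_integral_truncPow
    (hmom : ∀ b, ∀ i < k + 1, SameExp Q P fun x => (x - b) ^ i)
    {t : ℝ} (ht : ∫⁻ x, ENNReal.ofReal (truncPow (k + 1 + m) t x) ∂Q ≤
      ∫⁻ x, ENNReal.ofReal (truncPow (k + 1 + m) t x) ∂P) :
    ExpLE Q P fun x => ∫ u in a..x, (x - u) ^ k / k.factorial * truncPow m t u := by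
  have hT : ExpLE Q P (truncPow (k + 1 + m) t) := by
    have hmeas : Measurable (truncPow (k + 1 + m) t) := (truncPow_mono _ t).measurable
    have h0 : ∀ x, ENNReal.ofReal (-truncPow (k + 1 + m) t x) = 0 := fun x =>
      ENNReal.ofReal_eq_zero.2 (neg_nonpos.2 (truncPow_nonneg _ t x))
    exact ⟨hmeas.aemeasurable, hmeas.aemeasurable, by simp [h0], by simp [h0], by simpa [h0] using ht⟩
  have hS : SameExp Q P fun x => ∑ i ∈ Finset.range (k + 1),
      -(truncPow (k + 1 + m - i) t a / i.factorial) * (x - a) ^ i :=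
    SameExp.sum fun i hi => (hmom a i (Finset.mem_range.1 hi)).const_mul _
  have hadd := hT.add hS.expLE
  convert hadd using 2 with x
  have := taylor_of_isPrimitive (J := univ) ordConnected_univ
    (D := fun j => truncPow (k + 1 + m - j) t) (k := k) (fun j hj => by
      have h1 : k + 1 + m - j = (k + 1 + m - (j + 1)) + 1 := by omega
      rw [h1]
      exact isPrimitive_truncPow univ _ t) (mem_univ a) (mem_univ x)
  have h2 : k + 1 + m - (k + 1) = m := by omega
  simp only [tsub_zero, h2] at this
  rw [this]
  simp only [neg_mul, Finset.sum_neg_distrib]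
  ring

/-- Tonelli turns the comparison into one for each level `l`, where the layer is zero or a truncated
power. -/
theorem expLE_integral_of_chain [SFinite P] [SFinite Q] (hJ : IsLowerSet J)
    (hQJ : ∀ᵐ x ∂Q, x ∈ J) (hPJ : ∀ᵐ x ∂P, x ∈ J) (ha : a ∈ J) {H : ℕ → ℝ → ℝ}
    (hH : ∀ i < m, IsPrimitive J (H i) (H (i + 1))) (hH0 : ∀ i ≤ m, ∀ x ∈ J, 0 ≤ H i x)
    (hinf : ∀ i ≤ m, ∀ ε > 0, ∃ x ∈ J, H i x < ε) (hmono : ∀ i ≤ m, MonotoneOn (H i) J)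
    (hmom : ∀ b, ∀ i < k + 1, SameExp Q P fun x => (x - b) ^ i)
    (hQn : ∫⁻ x, ENNReal.ofReal (-(x - a) ^ (k + 1)) ∂Q ≠ ⊤)
    (hPn : ∫⁻ x, ENNReal.ofReal (-(x - a) ^ (k + 1)) ∂P ≠ ⊤)
    (htr : ∀ t ∈ J, ∫⁻ x, ENNReal.ofReal (truncPow (k + 1 + m) t x) ∂Q ≤
      ∫⁻ x, ENNReal.ofReal (truncPow (k + 1 + m) t x) ∂P) :
    ExpLE Q P fun x => ∫ u in a..x, (x - u) ^ k / k.factorial * H 0 u := by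
  have hJo : J.OrdConnected := hJ.ordConnected
  -- Values of `H m` off `J` are uncontrolled, while Tonelli needs a function measurable on the
  -- whole line.
  set G := J.indicator (H m) with hGdef
  have hG : Measurable G :=
    measurable_indicator_of_monotoneOn hJ (hmono m le_rfl) (hH0 m le_rfl)
  have hGH : EqOn G (H m) J := fun x hx => indicator_of_mem hx _
  have hA := measurable_layer hG m
  have hgJ : ∀ u ∈ J, ∫⁻ l, layer G m l u = ENNReal.ofReal (H 0 u) := fun u hu =>
    lintegral_layer hJ hH hH0 hinf hG hGH m 0 (zero_add m) hu
  set p : ℝ → ℝ≥0∞ := fun x => ∫⁻ l, taylorPos k a (layer G m l) x with hp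
  set q : ℝ → ℝ≥0∞ := fun x => ∫⁻ l, taylorNeg k a (layer G m l) x with hq
  have hmp := measurable_taylorPos hA k a
  have hmq := measurable_taylorNeg hA k a
  have rep : ∀ S : Measure ℝ, (∀ᵐ x ∂S, x ∈ J) →
      ∫⁻ x, ENNReal.ofReal (-(x - a) ^ (k + 1)) ∂S ≠ ⊤ →
      IsPosNegRep S (fun x => ∫ u in a..x, (x - u) ^ k / k.factorial * H 0 u) p q := by
    intro S hSJ hSn
    refine ⟨hmp.lintegral_prod_left.aemeasurable, hmq.lintegral_prod_left.aemeasurable, ?_, ?_⟩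
    · have hgm : MonotoneOn (fun u => ∫⁻ l, layer G m l u) J := by
        intro u hu v hv huv
        simp only [hgJ u hu, hgJ v hv]
        exact ENNReal.ofReal_le_ofReal (hmono 0 (Nat.zero_le m) hu hv huv)
      refine ne_top_of_le_ne_top (b := (∫⁻ x, ENNReal.ofReal (-(x - a) ^ (k + 1)) ∂S) *
        (ENNReal.ofReal ((k + 1).factorial : ℝ)⁻¹ * ENNReal.ofReal (H 0 a))) ?_ ?_
      · exact ENNReal.mul_ne_top hSn (ENNReal.mul_ne_top ENNReal.ofReal_ne_top ENNReal.ofReal_ne_top)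
      · rw [← lintegral_mul_const _ (by fun_prop)]
        refine lintegral_mono fun x => ?_
        have := taylorNeg_le hJ k ha hgm x
        simp only [taylorNeg_lintegral hA, hgJ a ha] at this
        refine this.trans (le_of_eq ?_)
        rw [div_eq_mul_inv, ENNReal.ofReal_mul' (by positivity), mul_assoc]
    · filter_upwards [hSJ] with x hx
      obtain ⟨h1, h2, h3⟩ := taylorPos_sub_taylorNeg hJo k ha hx (hH0 0 (Nat.zero_le m))
        (((hmono 0 (Nat.zero_le m)).mono (hJo.uIcc_subset ha hx)).intervalIntegrable)
        (Filter.Eventually.of_forall hgJ)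
      rw [taylorPos_lintegral hA] at h1 h3
      rw [taylorNeg_lintegral hA] at h2 h3
      exact ⟨h1, h2, h3.symm⟩
  have repQ := rep Q hQJ hQn
  have repP := rep P hPJ hPn
  refine .of_isPosNegRep repQ repP ?_
  have swp : ∀ S : Measure ℝ, SFinite S →
      ∫⁻ x, p x ∂S = ∫⁻ l, ∫⁻ x, taylorPos k a (layer G m l) x ∂S := fun S _ =>
    (lintegral_lintegral_swap hmp.aemeasurable).symm
  have swq : ∀ S : Measure ℝ, SFinite S →
      ∫⁻ x, q x ∂S = ∫⁻ l, ∫⁻ x, taylorNeg k a (layer G m l) x ∂S := fun S _ =>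
    (lintegral_lintegral_swap hmq.aemeasurable).symm
  have finQ := repQ.lintegral_neg
  have finP := repP.lintegral_neg
  rw [swq _ inferInstance] at finQ finP
  rw [swp _ inferInstance, swp _ inferInstance, swq _ inferInstance, swq _ inferInstance,
    ← lintegral_add_left hmp.lintegral_prod_right, ← lintegral_add_left hmp.lintegral_prod_right]
  refine lintegral_mono_ae ?_
  -- The negative parts are integrable over levels and points jointly, so at almost every level they
  -- are integrable under both laws.
  filter_upwards [ae_lt_top hmq.lintegral_prod_right finQ,
    ae_lt_top hmq.lintegral_prod_right finP] with l hlQ hlP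
  obtain ⟨h, hh0, hint, heq, hle⟩ : ∃ h : ℝ → ℝ, (∀ u, 0 ≤ h u) ∧
      (∀ x y, IntervalIntegrable h volume x y) ∧
      (∀ᵐ u, u ∈ J → layer G m l u = ENNReal.ofReal (h u)) ∧
      ExpLE Q P fun x => ∫ u in a..x, (x - u) ^ k / k.factorial * h u := by
    rcases layer_eq_zero_or_truncPow hJ (G := G)
      ((hmono m le_rfl).congr hGH.symm)
      (fun ε hε => (hinf m le_rfl ε hε).imp fun x (hx : x ∈ J ∧ H m x < ε) => ⟨hx.1, (hGH hx.1).symm ▸ hx.2⟩) l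
      with h0 | ⟨t, ht, h1⟩
    · refine ⟨fun _ => 0, fun _ => le_rfl, by simp, ?_, ?_⟩
      · exact Filter.Eventually.of_forall fun u hu => by simpa using h0 m u hu
      · have := (hmom 0 0 (Nat.succ_pos k)).const_mul 0
        simpa using this.expLE
    · refine ⟨truncPow m t, truncPow_nonneg m t,
        fun x y => ((truncPow_mono m t).monotoneOn _).intervalIntegrable, ?_,
        expLE_integral_truncPow hmom (htr t ht)⟩
      filter_upwards [Measure.ae_ne volume t] with u hu huJ using h1 m u huJ hu
  have rep' : ∀ S : Measure ℝ, (∀ᵐ x ∂S, x ∈ J) →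
      ∫⁻ x, taylorNeg k a (layer G m l) x ∂S < ⊤ →
      IsPosNegRep S (fun x => ∫ u in a..x, (x - u) ^ k / k.factorial * h u)
        (taylorPos k a (layer G m l)) (taylorNeg k a (layer G m l)) := by
    intro S hSJ hS
    refine ⟨(hmp.comp measurable_prodMk_left).aemeasurable,
      (hmq.comp measurable_prodMk_left).aemeasurable, hS.ne, ?_⟩
    filter_upwards [hSJ] with x hx
    obtain ⟨h1, h2, h3⟩ := taylorPos_sub_taylorNeg hJo k ha hx (fun u _ => hh0 u) (hint a x) heq
    exact ⟨h1, h2, h3.symm⟩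
  exact hle.lintegral_add_le (rep' Q hQJ hlQ) (rep' P hPJ hlP)

/-- `0 ≤ F x - F (x - 1) = ∫ g ≤ g x`, the last integral being over a unit interval ending at `x`.
-/
theorem nonneg_of_isPrimitive_of_monotoneOn (hJ : IsLowerSet J) {F g : ℝ → ℝ}
    (hF : IsPrimitive J F g) (hFm : MonotoneOn F J) (hgm : MonotoneOn g J) {x : ℝ} (hx : x ∈ J) :
    0 ≤ g x := by
  have hx1 : x - 1 ∈ J := hJ (by linarith) hx
  obtain ⟨hi, he⟩ := hF x hx (x - 1) hx1
  have h1 := hFm hx1 hx (by linarith)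
  have h2 : ∫ u in (x - 1)..x, g u ≤ ∫ _ in (x - 1)..x, g x :=
    intervalIntegral.integral_mono_on (by linarith) hi (by simp)
      fun u hu => hgm (hJ hu.2 hx) hx hu.2
  simp only [intervalIntegral.integral_const, sub_sub_cancel, one_smul] at h2
  linarith

theorem exists_lt_of_isPrimitive_of_nonneg (hJ : IsLowerSet J) (ha : a ∈ J) {F g : ℝ → ℝ}
    (hF : IsPrimitive J F g) (hF0 : ∀ x ∈ J, 0 ≤ F x) {ε : ℝ}
    (hε : 0 < ε) : ∃ x ∈ J, g x < ε := by
  by_contra! h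
  -- If `g ≥ ε` throughout `J`, then `F` drops by at least `F a + 1` from `a` to this `y`, so `F y <
  -- 0`.
  set y := a - (F a + 1) / ε with hy
  have hya : y ≤ a := by
    have : 0 ≤ (F a + 1) / ε := div_nonneg (by linarith [hF0 a ha]) hε.le
    linarith
  have hyJ := hJ hya ha
  obtain ⟨hi, he⟩ := hF a ha y hyJ
  have h2 : ∫ _ in y..a, ε ≤ ∫ u in y..a, g u :=
    intervalIntegral.integral_mono_on hya (by simp) hi fun u hu => h u (hJ hu.2 ha)
  have h3 : (a - y) * ε = F a + 1 := by
    rw [hy]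
    field_simp
    ring
  simp only [intervalIntegral.integral_const, smul_eq_mul, h3] at h2
  linarith [hF0 y hyJ]

theorem expLE_of_mem_FPlus [SFinite P] [SFinite Q] (hJ : IsLowerSet J)
    (hQJ : ∀ᵐ x ∂Q, x ∈ J) (hPJ : ∀ᵐ x ∂P, x ∈ J) (ha : a ∈ J)
    (hmom : ∀ b, ∀ i < k + 1, SameExp Q P fun x => (x - b) ^ i)
    (hpow : ExpLE Q P fun x => (x - a) ^ (k + 1))
    (htr : ∀ t ∈ J, ∫⁻ x, ENNReal.ofReal (truncPow (k + 1 + m) t x) ∂Q ≤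
      ∫⁻ x, ENNReal.ofReal (truncPow (k + 1 + m) t x) ∂P)
    {f : ℝ → ℝ} (hf : f ∈ FPlus (k + 1) (k + 1 + m) J) : ExpLE Q P f := by
  have hJo : J.OrdConnected := hJ.ordConnected
  obtain ⟨D, hD, hmono⟩ := hf
  have hprim : ∀ j < k + 1 + m, IsPrimitive J (D j) (D (j + 1)) := fun j hj => (hD.succ j hj).2
  have hnn : ∀ i ≤ m, ∀ x ∈ J, 0 ≤ D (k + 1 + i) x := by
    intro i hi x hx
    have e : k + 1 + i = k + i + 1 := by omega
    have h1 := hprim (k + i) (by omega)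
    have h2 := hmono (k + i) (by omega) (by omega)
    have h3 := hmono (k + i + 1) (by omega) (by omega)
    rw [e]
    exact nonneg_of_isPrimitive_of_monotoneOn hJ h1 h2 h3 hx
  set c := sInf (D (k + 1) '' J) with hc
  have hbdd : BddBelow (D (k + 1) '' J) :=
    ⟨0, by rintro _ ⟨x, hx, rfl⟩; exact hnn 0 (Nat.zero_le m) x hx⟩
  have hne : (D (k + 1) '' J).Nonempty := ⟨_, a, ha, rfl⟩
  have hc0 : 0 ≤ c := le_csInf hne (by rintro _ ⟨x, hx, rfl⟩; exact hnn 0 (Nat.zero_le m) x hx)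
  -- Only the bottom function needs its infimum removed: each higher one is the derivative of a
  -- nonnegative function on a lower set, so its infimum is already `0`.
  set H : ℕ → ℝ → ℝ := fun i x => D (k + 1 + i) x - if i = 0 then c else 0 with hHdef
  have hHm : ∀ i ≤ m, MonotoneOn (H i) J := fun i hi x hx y hy hxy =>
    sub_le_sub_right (hmono (k + 1 + i) (by omega) (by omega) hx hy hxy) _
  have hH0 : ∀ i ≤ m, ∀ x ∈ J, 0 ≤ H i x := by
    intro i hi x hx
    rcases Nat.eq_zero_or_pos i with rfl | hpos
    · simpa [H] using csInf_le hbdd ⟨x, hx, rfl⟩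
    · simpa [H, hpos.ne'] using hnn i hi x hx
  have hHp : ∀ i < m, IsPrimitive J (H i) (H (i + 1)) := by
    intro i hi x hx z hz
    obtain ⟨h1, h2⟩ := hprim (k + 1 + i) (by omega) x hx z hz
    have e : H (i + 1) = D (k + 1 + i + 1) := by
      ext u
      simp [H, add_assoc]
    rw [e]
    refine ⟨h1, ?_⟩
    simp only [H]
    rw [h2]
    ring
  have hinf : ∀ i ≤ m, ∀ ε > 0, ∃ x ∈ J, H i x < ε := by
    intro i hi ε hε
    rcases i with _ | i
    · obtain ⟨_, ⟨x, hx, rfl⟩, hlt⟩ := exists_lt_of_csInf_lt hne (lt_add_of_pos_right c hε)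
      refine ⟨x, hx, ?_⟩
      simp only [H, add_zero, if_true]
      linarith
    · exact exists_lt_of_isPrimitive_of_nonneg hJ ha (hHp i (by omega)) (hH0 i (by omega)) hε
  have main := expLE_integral_of_chain hJ hQJ hPJ ha hHp hH0 hinf hHm hmom hpow.neg_left
    hpow.neg_right htr
  have hpoly : SameExp Q P fun x => ∑ i ∈ Finset.range (k + 1),
      D i a / i.factorial * (x - a) ^ i :=
    SameExp.sum fun i hi => (hmom a i (Finset.mem_range.1 hi)).const_mul _
  have hsum := (hpoly.expLE.add
    (hpow.const_mul (c := c / (k + 1).factorial) (by positivity))).add main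
  have hEq : ∀ x ∈ J, ((∑ i ∈ Finset.range (k + 1), D i a / i.factorial * (x - a) ^ i) +
      c / (k + 1).factorial * (x - a) ^ (k + 1)) +
      ∫ u in a..x, (x - u) ^ k / k.factorial * H 0 u = f x := by
    intro x hx
    rw [← hD.zero hx, taylor_of_isPrimitive hJo (k := k) (fun j hj => hprim j (by omega)) ha hx, add_assoc]
    congr 1
    have i1 : IntervalIntegrable (fun u => (x - u) ^ k / k.factorial * H 0 u) volume a x :=
      (((hHm 0 (Nat.zero_le m)).mono (hJo.uIcc_subset ha hx)).intervalIntegrable).continuousOn_mul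
        (by fun_prop)
    have i2 : IntervalIntegrable (fun u => c * ((x - u) ^ k / k.factorial)) volume a x :=
      Continuous.intervalIntegrable (by fun_prop) _ _
    have e : (fun u => (x - u) ^ k / k.factorial * D (k + 1) u) = fun u =>
        c * ((x - u) ^ k / k.factorial) + (x - u) ^ k / k.factorial * H 0 u := by
      ext u
      simp only [H, add_zero, if_true]
      ring
    rw [e, intervalIntegral.integral_add i2 i1, intervalIntegral.integral_const_mul,
      integral_sub_pow_div_factorial]
    ring
  exact hsum.congr (hQJ.mono hEq) (hPJ.mono hEq)

end Core

/-! ### Extended expectations of composed functions -/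

theorem ereal_sub_le_sub_iff {a b c d : ℝ≥0∞} (hb : b ≠ ⊤) (hd : d ≠ ⊤) :
    (a : EReal) - (b : EReal) ≤ (c : EReal) - (d : EReal) ↔ a + d ≤ c + b := by
  lift b to NNReal using hb
  lift d to NNReal using hd
  by_cases ha : a = ⊤
  · subst ha
    by_cases hc : c = ⊤
    · subst hc
      simp
    · lift c to NNReal using hc
      have h1 : ((c : ℝ≥0∞) : EReal) - ((d : ℝ≥0∞) : EReal) = (((c : ℝ) - (d : ℝ) : ℝ) : EReal) := by
        rfl
      have h2 : ((⊤ : ℝ≥0∞) : EReal) - ((b : ℝ≥0∞) : EReal) = ⊤ := rfl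
      rw [h1, h2]
      constructor
      · intro h
        exact absurd (top_le_iff.1 h) (EReal.coe_ne_top _)
      · intro h
        rw [top_add, top_le_iff, ← ENNReal.coe_add] at h
        exact absurd h ENNReal.coe_ne_top
  · lift a to NNReal using ha
    have h1 : ((a : ℝ≥0∞) : EReal) - ((b : ℝ≥0∞) : EReal) = (((a : ℝ) - (b : ℝ) : ℝ) : EReal) := by
      rfl
    rw [h1]
    by_cases hc : c = ⊤
    · subst hc
      have h2 : ((⊤ : ℝ≥0∞) : EReal) - ((d : ℝ≥0∞) : EReal) = ⊤ := rfl
      rw [h2]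
      simp
    · lift c to NNReal using hc
      have h2 : ((c : ℝ≥0∞) : EReal) - ((d : ℝ≥0∞) : EReal) = (((c : ℝ) - (d : ℝ) : ℝ) : EReal) := by
        rfl
      rw [h2, EReal.coe_le_coe_iff, ← ENNReal.coe_add, ← ENNReal.coe_add, ENNReal.coe_le_coe,
        ← NNReal.coe_le_coe]
      push_cast
      constructor <;> intro h <;> linarith

section Transfer

variable {Ω₁ Ω₂ : Type*} [MeasurableSpace Ω₁] [MeasurableSpace Ω₂]
  {μ : Measure Ω₁} {ν : Measure Ω₂}

theorem ExpExists.lintegral_neg_ne_top {Z : Ω₁ → ℝ} (h : ExpExists μ Z) (hb : ⊥ < extExp μ Z) :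
    ∫⁻ ω, ENNReal.ofReal (-Z ω) ∂μ ≠ ⊤ := by
  intro htop
  have hp := h.2.resolve_right (not_not.2 htop)
  rw [extExp, htop] at hb
  lift ∫⁻ ω, ENNReal.ofReal (Z ω) ∂μ to NNReal using hp with a
  have : ((a : ℝ≥0∞) : EReal) - ((⊤ : ℝ≥0∞) : EReal) = ⊥ := rfl
  rw [this] at hb
  exact lt_irrefl _ hb

theorem integrable_of_lintegral_ofReal {Z : Ω₁ → ℝ} (hZ : AEMeasurable Z μ)
    (hp : ∫⁻ ω, ENNReal.ofReal (Z ω) ∂μ ≠ ⊤) (hn : ∫⁻ ω, ENNReal.ofReal (-Z ω) ∂μ ≠ ⊤) :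
    Integrable Z μ := by
  refine ⟨hZ.aestronglyMeasurable, ?_⟩
  refine lt_of_le_of_lt ?_ (ENNReal.add_ne_top.2 ⟨hp, hn⟩).lt_top
  rw [← lintegral_add_left' hZ.ennreal_ofReal]
  refine lintegral_mono fun ω => ?_
  rw [Real.enorm_eq_ofReal_abs]
  rcases abs_cases (Z ω) with ⟨h, _⟩ | ⟨h, _⟩ <;> rw [h] <;> simp

theorem extExp_eq_integral {Z : Ω₁ → ℝ} (hZ : Integrable Z μ) :
    extExp μ Z = ((∫ ω, Z ω ∂μ : ℝ) : EReal) := by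
  rw [integral_eq_lintegral_pos_part_sub_lintegral_neg_part hZ, extExp]
  have hp := hZ.lintegral_lt_top.ne
  have hn : ∫⁻ ω, ENNReal.ofReal (-Z ω) ∂μ ≠ ⊤ := hZ.neg.lintegral_lt_top.ne
  rw [EReal.coe_sub, EReal.coe_ennreal_toReal hp, EReal.coe_ennreal_toReal hn]

variable {U : Ω₁ → ℝ} {V : Ω₂ → ℝ}

theorem lintegral_ofReal_neg_map (hU : Measurable U) {g : ℝ → ℝ} (hg : AEMeasurable g (μ.map U)) :
    ∫⁻ x, ENNReal.ofReal (-g x) ∂(μ.map U) = ∫⁻ ω, ENNReal.ofReal (-g (U ω)) ∂μ :=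
  lintegral_map' hg.neg.ennreal_ofReal hU.aemeasurable

theorem ExpLE.extExp_le (hU : Measurable U) (hV : Measurable V) {g : ℝ → ℝ}
    (h : ExpLE (ν.map V) (μ.map U) g) :
    ExpExists μ (fun ω => g (U ω)) ∧ ExpExists ν (fun ω => g (V ω)) ∧
      extExp ν (fun ω => g (V ω)) ≤ extExp μ (fun ω => g (U ω)) := by
  obtain ⟨h1, h2, h3, h4, h5⟩ := h
  rw [lintegral_ofReal_neg_map hV h1, lintegral_ofReal_neg_map hU h2,
    lintegral_map' h1.ennreal_ofReal hV.aemeasurable,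
    lintegral_map' h2.ennreal_ofReal hU.aemeasurable] at h5
  rw [lintegral_ofReal_neg_map hV h1] at h3
  rw [lintegral_ofReal_neg_map hU h2] at h4
  exact ⟨⟨h2.comp_measurable hU, Or.inr h4⟩, ⟨h1.comp_measurable hV, Or.inr h3⟩,
    (ereal_sub_le_sub_iff h3 h4).2 h5⟩

theorem ExpLE.of_extExp_le (hU : Measurable U) (hV : Measurable V) {g : ℝ → ℝ} (hg : Measurable g)
    (hUn : ∫⁻ ω, ENNReal.ofReal (-g (U ω)) ∂μ ≠ ⊤) (hVn : ∫⁻ ω, ENNReal.ofReal (-g (V ω)) ∂ν ≠ ⊤)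
    (h : extExp ν (fun ω => g (V ω)) ≤ extExp μ (fun ω => g (U ω))) :
    ExpLE (ν.map V) (μ.map U) g := by
  have h' := (ereal_sub_le_sub_iff hVn hUn).1 h
  refine ⟨hg.aemeasurable, hg.aemeasurable, ?_, ?_, ?_⟩
  · rwa [lintegral_ofReal_neg_map hV hg.aemeasurable]
  · rwa [lintegral_ofReal_neg_map hU hg.aemeasurable]
  · rwa [lintegral_ofReal_neg_map hU hg.aemeasurable, lintegral_ofReal_neg_map hV hg.aemeasurable,
      lintegral_map hg.ennreal_ofReal hU, lintegral_map hg.ennreal_ofReal hV]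

theorem SameExp.of_map (hU : Measurable U) (hV : Measurable V) {g : ℝ → ℝ} (hg : Continuous g)
    (hUi : Integrable (fun ω => g (U ω)) μ) (hVi : Integrable (fun ω => g (V ω)) ν)
    (h : ∫ ω, g (V ω) ∂ν = ∫ ω, g (U ω) ∂μ) : SameExp (ν.map V) (μ.map U) g :=
  ⟨(integrable_map_measure hg.aestronglyMeasurable hV.aemeasurable).2 hVi,
    (integrable_map_measure hg.aestronglyMeasurable hU.aemeasurable).2 hUi, by
    rw [integral_map hV.aemeasurable hg.aestronglyMeasurable,
      integral_map hU.aemeasurable hg.aestronglyMeasurable, h]⟩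

end Transfer

/-! ### Members of the cone -/

theorem mem_LD_of_continuous {g : ℝ → ℝ} (hg : Continuous g) (J : Set ℝ) : g ∈ LD J :=
  ⟨fun _ _ _ => hg.continuousWithinAt, fun _ _ => hg.continuousWithinAt⟩

theorem polynomial_mem_FMinus (I : Set ℝ) {k : ℕ} (n : ℕ) {p : Polynomial ℝ} (hp : p.natDegree ≤ k)
    (h : ∀ x, 0 ≤ (-1 : ℝ) ^ k * (Polynomial.derivative^[k] p).eval x) :
    (fun x => p.eval x) ∈ FMinus k n I := by
  set D : ℕ → ℝ → ℝ := fun j y => (-1 : ℝ) ^ j * (Polynomial.derivative^[j] p).eval (-y) with hD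
  have hc : ∀ j, Continuous (D j) := fun j => by
    simp only [hD]
    fun_prop
  have hder : ∀ j y, HasDerivAt (D j) (D (j + 1) y) y := by
    intro j y
    have h1 := (((Polynomial.derivative^[j] p).hasDerivAt (-y)).comp y (hasDerivAt_neg y)).const_mul
      ((-1 : ℝ) ^ j)
    refine h1.congr_deriv ?_
    simp only [hD, Function.iterate_succ_apply', pow_succ]
    ring
  refine ⟨fun y => p.eval (-y), ⟨D, ⟨?_, ?_, ?_⟩, ?_⟩, fun x => by simp⟩
  · have : Continuous fun y : ℝ => p.eval (-y) := by fun_prop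
    exact this.measurable.comp measurable_subtype_coe
  · intro y _
    simp [hD]
  · refine fun j _ => ⟨mem_LD_of_continuous (hc _) _, fun x _ z _ => ?_⟩
    have hi := (hc (j + 1)).intervalIntegrable (μ := volume) z x
    refine ⟨hi, ?_⟩
    rw [intervalIntegral.integral_eq_sub_of_hasDerivAt (fun y _ => hder j y) hi]
    ring
  · intro j hj _
    refine (monotone_of_deriv_nonneg (fun y => (hder j y).differentiableAt) fun y => ?_).monotoneOn _
    rw [(hder j y).deriv]
    -- For `j = k - 1` the derivative is the signed `k`-th derivative of `p`; for larger `j` it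
    -- vanishes by degree.
    rcases hj.eq_or_lt with rfl | hlt
    · exact h _
    · simp [hD, Polynomial.iterate_derivative_eq_zero (hp.trans_lt hlt)]

/-- For `i = 0` the jump at `t` is right-continuous; it violates the convention only if `t` is the
right endpoint, where left-continuity is required. -/
theorem truncPow_mem_LD {J : Set ℝ} (i : ℕ) {t : ℝ} (ht : t ∈ J) (ht' : ¬ IsGreatest J t) :
    truncPow i t ∈ LD J := by
  rcases Nat.eq_zero_or_pos i with rfl | hi
  · have h1 : ∀ x, t ≤ x → truncPow 0 t x = 1 := fun x hx => by simp [truncPow_of_le hx]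
    refine ⟨fun x _ _ => ?_, fun x hx => ?_⟩
    · rcases le_or_gt t x with h | h
      · exact continuousWithinAt_const.congr (fun y hy => h1 y (h.trans hy.2)) (h1 x h)
      · refine ContinuousAt.continuousWithinAt ?_
        refine (continuousAt_const (y := (0 : ℝ))).congr ?_
        filter_upwards [Iio_mem_nhds h] with y hy using (truncPow_of_lt hy).symm
    · have hlt : t < x := lt_of_le_of_ne (hx.2 ht) fun h => ht' (h ▸ hx)
      refine ContinuousAt.continuousWithinAt ?_
      refine (continuousAt_const (y := (1 : ℝ))).congr ?_
      filter_upwards [Ioi_mem_nhds hlt] with y hy using (h1 y (le_of_lt hy)).symm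
  · exact mem_LD_of_continuous (continuous_truncPow hi.ne' t) J

theorem const_mul_mem_LD {J : Set ℝ} {g : ℝ → ℝ} (hg : g ∈ LD J) (c : ℝ) :
    (fun x => c * g x) ∈ LD J :=
  ⟨fun x hx hx' => (hg.1 x hx hx').const_mul c, fun x hx => (hg.2 x hx).const_mul c⟩

theorem max_pow_mem_FMinus {I : Set ℝ} (k : ℕ) {n : ℕ} (hn : n ≠ 0) {t : ℝ} (ht : t ∈ I)
    (ht' : ¬ IsGreatest (-I) (-t)) : (fun x => max (t - x) 0 ^ n) ∈ FMinus k n I := by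
  have hn0 : (n.factorial : ℝ) ≠ 0 := by positivity
  refine ⟨fun y => max (y - -t) 0 ^ n, ⟨fun j y => n.factorial * truncPow (n - j) (-t) y,
    ⟨?_, ?_, ?_⟩, ?_⟩, fun x => ?_⟩
  · have : Continuous fun y : ℝ => max (y - -t) 0 ^ n := by fun_prop
    exact this.measurable.comp measurable_subtype_coe
  · intro y _
    simp only [tsub_zero, truncPow_eq_max hn]
    field_simp
  · intro j hj
    refine ⟨const_mul_mem_LD (truncPow_mem_LD _ (by simpa using ht) ht') _, fun x hx z hz => ?_⟩
    obtain ⟨h1, h2⟩ := isPrimitive_truncPow (-I) (n - (j + 1)) (-t) x hx z hz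
    have e : n - j = n - (j + 1) + 1 := by omega
    refine ⟨h1.const_mul _, ?_⟩
    rw [intervalIntegral.integral_const_mul, e]
    beta_reduce
    rw [h2]
    ring
  · intro j _ _
    exact (((truncPow_mono (n - j) (-t)).const_mul (by positivity))).monotoneOn _
  · ring_nf

theorem isLowerSet_neg_of_ordConnected {I : Set ℝ} (hI : I.OrdConnected) (hb : ¬ BddAbove I) :
    IsLowerSet (-I) := by
  intro x y hyx hx
  rw [Set.mem_neg] at hx ⊢
  obtain ⟨w, hw, hlt⟩ := not_bddAbove_iff.1 hb (-y)
  exact hI.out hx hw ⟨neg_le_neg hyx, hlt.le⟩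

theorem natDegree_X_sub_C_pow_le (c : ℝ) (i : ℕ) :
    ((Polynomial.X - Polynomial.C c) ^ i).natDegree ≤ i := by
  rw [Polynomial.natDegree_pow, Polynomial.natDegree_X_sub_C, mul_one]

/-- The polynomial `(c - x)ᵏ` as a test function. -/
theorem test_const_sub_pow (c : ℝ) (k : ℕ) :
    ((Polynomial.C c - Polynomial.X) ^ k).natDegree ≤ k ∧
      ∀ x : ℝ, 0 ≤ (-1 : ℝ) ^ k *
        (Polynomial.derivative^[k] ((Polynomial.C c - Polynomial.X) ^ k)).eval x := by
  have e : (Polynomial.C c - Polynomial.X) ^ k =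
      Polynomial.C ((-1 : ℝ) ^ k) * (Polynomial.X - Polynomial.C c) ^ k := by
    rw [← neg_sub, neg_pow]
    simp
  rw [e]
  refine ⟨(Polynomial.natDegree_C_mul_le _ _).trans (natDegree_X_sub_C_pow_le c k), fun x => ?_⟩
  rw [Polynomial.iterate_derivative_C_mul, Polynomial.iterate_derivative_X_sub_pow_self]
  simp only [Polynomial.eval_mul, Polynomial.eval_C, Polynomial.eval_natCast]
  rw [← mul_assoc, ← mul_pow]
  simp

/-- Polynomials of degree less than `k` are test functions. -/
theorem test_of_natDegree_lt {p : Polynomial ℝ} {k : ℕ} (hp : p.natDegree < k) :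
    p.natDegree ≤ k ∧ ∀ x : ℝ, 0 ≤ (-1 : ℝ) ^ k * (Polynomial.derivative^[k] p).eval x :=
  ⟨hp.le, fun x => by simp [Polynomial.iterate_derivative_eq_zero hp]⟩

end MultiplyMonotone

/-! ### The equivalence -/

theorem mainTheorem11
    {Ω₁ Ω₂ : Type*} [MeasurableSpace Ω₁] [MeasurableSpace Ω₂]
    (μ : Measure Ω₁) [IsProbabilityMeasure μ] (ν : Measure Ω₂) [IsProbabilityMeasure ν]
    (k n : ℕ) (hk : 1 ≤ k) (hkn : k ≤ n)
    (I : Set ℝ) (hI : I.OrdConnected) (hb : ¬ BddAbove I)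
    (X : Ω₁ → ℝ) (Y : Ω₂ → ℝ) (hX : Measurable X) (hY : Measurable Y)
    (hXI : ∀ ω, X ω ∈ I) (hYI : ∀ ω, Y ω ∈ I)
    (hadm : ∀ p : Polynomial ℝ, p.natDegree ≤ k →
      (∀ x : ℝ, 0 ≤ (-1 : ℝ) ^ k * (Polynomial.derivative^[k] p).eval x) →
      (MultiplyMonotone.ExpExists μ (fun ω => p.eval (X ω)) ∧
        ⊥ < MultiplyMonotone.extExp μ (fun ω => p.eval (X ω))) ∧
      (MultiplyMonotone.ExpExists ν (fun ω => p.eval (Y ω)) ∧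
        ⊥ < MultiplyMonotone.extExp ν (fun ω => p.eval (Y ω))))
    (s z : ℝ) :
    (∀ f ∈ MultiplyMonotone.FMinus k n I,
      MultiplyMonotone.ExpExists μ (fun ω => f (X ω)) ∧
      MultiplyMonotone.ExpExists ν (fun ω => f (Y ω)) ∧
      MultiplyMonotone.extExp ν (fun ω => f (Y ω)) ≤
        MultiplyMonotone.extExp μ (fun ω => f (X ω))) ↔
    ((∀ i : ℕ, 1 ≤ i → i ≤ k - 1 →
        Integrable (fun ω => (X ω - s) ^ i) μ ∧ Integrable (fun ω => (Y ω - s) ^ i) ν ∧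
        ∫ ω, (X ω - s) ^ i ∂μ = ∫ ω, (Y ω - s) ^ i ∂ν) ∧
      (MultiplyMonotone.ExpExists μ (fun ω => (z - X ω) ^ k) ∧
        MultiplyMonotone.ExpExists ν (fun ω => (z - Y ω) ^ k) ∧
        MultiplyMonotone.extExp ν (fun ω => (z - Y ω) ^ k) ≤
          MultiplyMonotone.extExp μ (fun ω => (z - X ω) ^ k)) ∧
      (∀ t ∈ I,
        MultiplyMonotone.ExpExists μ (fun ω => (max (t - X ω) 0) ^ n) ∧
        MultiplyMonotone.ExpExists ν (fun ω => (max (t - Y ω) 0) ^ n) ∧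
        MultiplyMonotone.extExp ν (fun ω => (max (t - Y ω) 0) ^ n) ≤
          MultiplyMonotone.extExp μ (fun ω => (max (t - X ω) 0) ^ n))) := by
  open MultiplyMonotone in
  obtain ⟨hzdeg, hzder⟩ := test_const_sub_pow z k
  have hn : n ≠ 0 := by omega
  constructor
  · intro hF
    refine ⟨fun i _ hik => ?_, ?_, fun t ht => ?_⟩
    · set p : Polynomial ℝ := (Polynomial.X - Polynomial.C s) ^ i with hp
      have hdeg : p.natDegree < k := (natDegree_X_sub_C_pow_le s i).trans_lt (by omega)
      obtain ⟨h1, h2⟩ := test_of_natDegree_lt hdeg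
      -- Below degree `k` both `p` and `-p` are admissible and in the cone, giving integrability and
      -- equality of moments.
      obtain ⟨h1', h2'⟩ := test_of_natDegree_lt (p := -p) (by rwa [Polynomial.natDegree_neg])
      obtain ⟨⟨a1, a2⟩, b1, b2⟩ := hadm p h1 h2
      obtain ⟨⟨a1', a2'⟩, b1', b2'⟩ := hadm (-p) h1' h2'
      have a3 := a1.lintegral_neg_ne_top a2
      have a3' := a1'.lintegral_neg_ne_top a2'
      have b3 := b1.lintegral_neg_ne_top b2
      have b3' := b1'.lintegral_neg_ne_top b2'
      simp only [Polynomial.eval_neg, neg_neg] at a3' b3'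
      have iX := integrable_of_lintegral_ofReal a1.1 a3' a3
      have iY := integrable_of_lintegral_ofReal b1.1 b3' b3
      have l1 := (hF _ (polynomial_mem_FMinus I n h1 h2)).2.2
      have l2 := (hF _ (polynomial_mem_FMinus I n h1' h2')).2.2
      simp only [Polynomial.eval_neg] at l2
      rw [extExp_eq_integral iX, extExp_eq_integral iY, EReal.coe_le_coe_iff] at l1
      rw [extExp_eq_integral iX.fun_neg, extExp_eq_integral iY.fun_neg, EReal.coe_le_coe_iff,
        integral_neg, integral_neg, neg_le_neg_iff] at l2
      have e : ∀ x, p.eval x = (x - s) ^ i := fun x => by simp [hp]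
      simp only [e] at iX iY l1 l2
      exact ⟨iX, iY, le_antisymm l2 l1⟩
    · simpa using hF _ (polynomial_mem_FMinus I n hzdeg hzder)
    -- This is the case `t = min I`, where `truncPow 0 (-t)` jumps at the right endpoint of `-I`;
    -- the truncated power is then zero on `I`.
    · by_cases hg : IsGreatest (-I) (-t)
      · have h0 : ∀ x ∈ I, max (t - x) 0 ^ n = 0 := by
          intro x hx
          have := hg.2 (show -x ∈ -I by simpa using hx)
          rw [max_eq_right (by linarith), zero_pow hn]
        have hμ : (fun ω => max (t - X ω) 0 ^ n) = fun _ => 0 := funext fun ω => h0 _ (hXI ω)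
        have hν : (fun ω => max (t - Y ω) 0 ^ n) = fun _ => 0 := funext fun ω => h0 _ (hYI ω)
        rw [hμ, hν]
        simp [ExpExists, extExp]
      · exact hF _ (max_pow_mem_FMinus k hn ht hg)
  · rintro ⟨hi, ⟨_, _, hii⟩, hiii⟩ f ⟨g, hg, hfg⟩
    simp only [hfg]
    obtain ⟨k, rfl⟩ : ∃ l, k = l + 1 := ⟨k - 1, by omega⟩
    obtain ⟨m, rfl⟩ : ∃ m, n = k + 1 + m := ⟨n - (k + 1), by omega⟩
    have hU : Measurable fun ω => -X ω := hX.neg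
    have hV : Measurable fun ω => -Y ω := hY.neg
    have hJ := isLowerSet_neg_of_ordConnected hI hb
    have hJm : MeasurableSet (-I) := hJ.ordConnected.measurableSet
    have hPJ : ∀ᵐ x ∂(μ.map fun ω => -X ω), x ∈ -I := by
      refine (ae_map_iff hU.aemeasurable (p := fun x => x ∈ -I) hJm).2 ?_
      exact Filter.Eventually.of_forall fun ω => by simpa using hXI ω
    have hQJ : ∀ᵐ x ∂(ν.map fun ω => -Y ω), x ∈ -I := by
      refine (ae_map_iff hV.aemeasurable (p := fun x => x ∈ -I) hJm).2 ?_
      exact Filter.Eventually.of_forall fun ω => by simpa using hYI ω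
    obtain ⟨a, ha⟩ : (-I).Nonempty := by
      obtain ⟨w, hw, _⟩ := not_bddAbove_iff.1 hb 0
      exact ⟨-w, by simpa using hw⟩
    have hmom0 : ∀ i < k + 1,
        SameExp (ν.map fun ω => -Y ω) (μ.map fun ω => -X ω) fun x => (x - -s) ^ i := by
      intro i hik
      have e : ∀ x : ℝ, (-x - -s) ^ i = (-1) ^ i * (x - s) ^ i := fun x => by
        rw [← mul_pow]
        ring
      rcases Nat.eq_zero_or_pos i with rfl | hpos
      · exact SameExp.of_map hU hV (by fun_prop) (by simp) (by simp) (by simp)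
      · obtain ⟨h1, h2, h3⟩ := hi i hpos (by omega)
        refine SameExp.of_map hU hV (by fun_prop) ?_ ?_ ?_
        · simpa only [e] using h1.const_mul _
        · simpa only [e] using h2.const_mul _
        · simp only [e, integral_const_mul, h3]
    have hmom := fun b => SameExp.sub_pow hmom0 b
    have hpowz : ExpLE (ν.map fun ω => -Y ω) (μ.map fun ω => -X ω)
        fun x => (x - -z) ^ (k + 1) := by
      obtain ⟨⟨a1, a2⟩, b1, b2⟩ := hadm _ hzdeg hzder
      have a3 := a1.lintegral_neg_ne_top a2
      have b3 := b1.lintegral_neg_ne_top b2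
      have e : ∀ x : ℝ, -x - -z = z - x := fun x => by ring
      refine ExpLE.of_extExp_le hU hV (by fun_prop) ?_ ?_ ?_
      · simpa [e] using a3
      · simpa [e] using b3
      · simpa only [e] using hii
    -- `-z` need not lie in `-I`, but the Taylor centre must, so the power is recentred at `a`.
    have hpow : ExpLE (ν.map fun ω => -Y ω) (μ.map fun ω => -X ω) fun x => (x - a) ^ (k + 1) :=
      ExpLE.sub_pow (hmom _) hpowz
    refine ExpLE.extExp_le hU hV (expLE_of_mem_FPlus hJ hQJ hPJ ha hmom hpow (fun t ht => ?_) hg)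
    have hnn : ∀ x : ℝ, 0 ≤ max (x - t) 0 ^ (k + 1 + m) := fun x => by positivity
    have hT : ExpLE (ν.map fun ω => -Y ω) (μ.map fun ω => -X ω)
        fun x => max (x - t) 0 ^ (k + 1 + m) := by
      have e : ∀ x : ℝ, -x - t = -t - x := fun x => by ring
      refine ExpLE.of_extExp_le hU hV (by fun_prop) ?_ ?_ ?_
      · simp [ENNReal.ofReal_eq_zero.2 (neg_nonpos.2 (hnn _))]
      · simp [ENNReal.ofReal_eq_zero.2 (neg_nonpos.2 (hnn _))]
      · simpa only [e] using (hiii (-t) ht).2.2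
    have hT' := (hT.const_mul (c := ((k + 1 + m).factorial : ℝ)⁻¹) (by positivity)).le
    have e : ∀ x, ((k + 1 + m).factorial : ℝ)⁻¹ * max (x - t) 0 ^ (k + 1 + m) =
        truncPow (k + 1 + m) t x := fun x => by
      rw [truncPow_eq_max hn, div_eq_inv_mul]
    simpa [e, ENNReal.ofReal_eq_zero.2 (neg_nonpos.2 (truncPow_nonneg _ _ _))] using hT'
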